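/- Let $\{\phi_{ni}(\beta) : 1\le i\le n,\ n\ge 1\}$ be a triangular array of real random functions on a probability space, indexed by a scalar parameter $\beta\in\mathcal B\subset\mathbb R$, with each $\phi_{ni}(\beta)$ measurable. Let $\beta_0\in\mathbb R$ and $\delta_0>0$ be such that $(\beta_0-\delta_0,\beta_0+\delta_0)\subset\mathcal B$, and suppose that almost surely each $\phi_{ni}$ is twice differentiable in $\beta$ on this interval, with derivatives $\phi_{1ni}(\beta)$ and $\phi_{2ni}(\beta)$. Write $\phi_{ni}=\phi_{ni}(\beta_0)$ and $\phi_{1ni}=\phi_{1ni}(\beta_0)$, and assume that $E\phi_{ni}^2<\infty$ and $E|\phi_{1ni}|<\infty$. Put $$a_n=\Big[\sum_{i=1}^nE\phi_{ni}^2\Big]^{1/2},\qquad \gamma_{1n}=a_n^{-2}\sum_{i=1}^nE\phi_{1ni},\qquad \eta_n=\max(\sigma_n^2,1),$$ where $(\sigma_n)$ is any sequence of real numbers (in the bootstrap application, the standard deviations of the weights). Assume that $a_n\to\infty$; that for every $n$ there are $\sigma$-fields $\mathcal F_{n1}\subset\dots\subset\mathcal F_{nn}$ for which $\{\sum_{i=1}^j\phi_{ni},\mathcal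 F_{nj}\}_{1\le j\le n}$ is a martingale; and that * (3.2) $E\phi_{ni}=0$ for all $1\le i\le n$, $n\ge1$; * (3.3) there is a constant $k_2>0$ with $\gamma_{1n}>k_2$ for all large $n$; * (3.4) $E\big[\sum_{i=1}^n(\phi_{1ni}-E\phi_{1ni})\big]^2=o(a_n^4\eta_n^{-1})$; * (3.5) there are random variables $M_{2ni}$ such that almost surely $\sup_{|\beta-\beta_0|<\delta_0}|\phi_{2ni}(\beta)|\le M_{2ni}$, and $E\big(\sum_{i=1}^nM_{2ni}\big)^2=o(a_n^6\eta_n^{-1})$ (the second moments in (3.4) and (3.5) being finite for every $n$). Then there is a sequence of $\mathcal B$-valued random variables $\hat\beta_n$ such that the following hold. For every $n$, almost surely, $\hat\beta_n$ is a root of $\sum_{i=1}^n\phi_{ni}(\beta)=0$ whenever this equation has a root in $(\beta_0-\delta_0,\beta_0+\delta_0)$; the probability that $\hat\beta_n$ is a root tends to one as $n\to\infty$; and $$a_n(\hat\beta_n-\beta_0)=O_P(1),\qquad a_n\gamma_{1n}(\hat\beta_n-\beta_0)=-a_n^{-1}\sum_{i=1}^n\phi_{ni}+o_P(1).$$ If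 in addition $X_{ni}=a_n^{-1}\phi_{ni}$ satisfies * (3.6) $\sum_{i=1}^nX_{ni}^2\to1$ in probability and $E\max_{1\le i\le n}|X_{ni}|\to0$, then $$a_n^{-1}\Big(\sum_{i=1}^nE\phi_{1ni}\Big)(\hat\beta_n-\beta_0)\ \xrightarrow{D}\ N(0,1),$$ and if moreover $\gamma_{1n}\to1$, then also $\big[\sum_{i=1}^nE\phi_{1ni}\big]^{1/2}(\hat\beta_n-\beta_0)\xrightarrow{D}N(0,1)$. -/

import Mathlib

open MeasureTheory ProbabilityTheory Filter Topology Asymptotics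

noncomputable section

namespace EstimatingEquation

variable {Ω : Type*} [MeasurableSpace Ω]

/-- `X n = O_P(1)`: the sequence is bounded in probability. -/
def BoundedInProbability (P : Measure Ω) (X : ℕ → Ω → ℝ) : Prop :=
  ∀ ε : ℝ, 0 < ε → ∃ C : ℝ, ∀ᶠ n in atTop, P {ω | C < |X n ω|} ≤ ENNReal.ofReal ε

/-- The estimating function `∑ᵢ φₙᵢ(β)` of the `n`th row, at the sample point `ω`. -/
def total (φ : (n : ℕ) → Fin n → Ω → ℝ → ℝ) (n : ℕ) (ω : Ω) (β : ℝ) : ℝ :=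
  ∑ i, φ n i ω β

/-- The norming constant `aₙ = (∑ᵢ E φₙᵢ(β₀)²)^{1/2}`. -/
def scale (P : Measure Ω) (φ : (n : ℕ) → Fin n → Ω → ℝ → ℝ) (β₀ : ℝ) (n : ℕ) : ℝ :=
  √(∑ i, ∫ ω, (φ n i ω β₀) ^ 2 ∂P)

/-- The expected slope `∑ᵢ E φ₁ₙᵢ(β₀)`, where `φ₁` is the derivative of `φ` in the parameter. -/
def slope (P : Measure Ω) (φ₁ : (n : ℕ) → Fin n → Ω → ℝ → ℝ) (β₀ : ℝ) (n : ℕ) : ℝ :=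
  ∑ i, ∫ ω, φ₁ n i ω β₀ ∂P

/-- The normalized expected slope `γ₁ₙ = aₙ⁻² ∑ᵢ E φ₁ₙᵢ(β₀)`. -/
def gamma (P : Measure Ω) (φ φ₁ : (n : ℕ) → Fin n → Ω → ℝ → ℝ) (β₀ : ℝ) (n : ℕ) : ℝ :=
  (scale P φ β₀ n ^ 2)⁻¹ * slope P φ₁ β₀ n

/-- `ηₙ = max(σₙ², 1)`. -/
def eta (σ : ℕ → ℝ) (n : ℕ) : ℝ := max (σ n ^ 2) 1

/-- The normalized array `Xₙᵢ = (∑ⱼ E φₙⱼ(β₀)²)^{-1/2} φₙᵢ(β₀)`. -/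
def normalized (P : Measure Ω) (φ : (n : ℕ) → Fin n → Ω → ℝ → ℝ) (β₀ : ℝ)
    (n : ℕ) (i : Fin n) (ω : Ω) : ℝ :=
  (scale P φ β₀ n)⁻¹ * φ n i ω β₀

end EstimatingEquation

end

noncomputable section

namespace EstimatingEquation

/-! ### Martingale central limit theorem by McLeish's product method -/

section MartingaleCLT

/-! Write `a` for the norming constant, `γ` for the normalized slope and `y = β - β₀`. On the ball,
the estimating function equals `a u + a² (γ + v) y` up to an error of at most `a³ w y²`. Here `u` is
the normalized score, whose second moment is at most one because martingale differences are
orthogonal; `v` and `w` tend to zero in `L²` by the moment hypotheses. At `y = ± C / a`, after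
division by `a`, this reads `u ± C (γ + v)` with error at most `C² w`. Since `γ > k₂`, the linear
term wins for large `C` with probability close to one, so the function changes sign and has a root
within `C / a` of `β₀`. The estimator is a measurably chosen root closest to `β₀`
(`exists_measurable_closest_root`), hence it is at least as close; inserting it into the expansion
gives the linear representation (`closest_root_asymptotics`).

Normality reduces to that of `-u`. With `T = ∏ (1 + i t Zₖ)` over the truncated differences, `E T =
1`, while `exp (i t S)` is close to `T exp (-t² / 2)` when the sum of squares is near one and the
largest term is small. Integrating gives the Gaussian characteristic function
(`tendstoInDistribution_sum_of_martingaleDifference`); Slutsky's theorem does the rest. -/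

lemma norm_prod_sub_prod_le {ι : Type*} {s : Finset ι} {f g : ι → ℂ} (hf : ∀ i ∈ s, ‖f i‖ ≤ 1)
    (hg : ∀ i ∈ s, ‖g i‖ ≤ 1) : ‖∏ i ∈ s, f i - ∏ i ∈ s, g i‖ ≤ ∑ i ∈ s, ‖f i - g i‖ := by
  classical
  induction s using Finset.induction_on with
  | empty => simp
  | insert a s ha ih =>
    simp only [Finset.forall_mem_insert] at hf hg
    rw [Finset.prod_insert ha, Finset.prod_insert ha, Finset.sum_insert ha]
    have h1 : ‖∏ i ∈ s, f i‖ ≤ 1 := by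
      rw [norm_prod]; exact Finset.prod_le_one (fun _ _ => norm_nonneg _) hf.2
    calc _ = ‖(f a - g a) * ∏ i ∈ s, f i + g a * (∏ i ∈ s, f i - ∏ i ∈ s, g i)‖ := by
          congr 1; ring
      _ ≤ ‖f a - g a‖ * ‖∏ i ∈ s, f i‖ + ‖g a‖ * ‖∏ i ∈ s, f i - ∏ i ∈ s, g i‖ := by
          rw [← norm_mul, ← norm_mul]; exact norm_add_le _ _
      _ ≤ ‖f a - g a‖ * 1 + 1 * ∑ i ∈ s, ‖f i - g i‖ := by
          gcongr
          · exact hg.1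
          · exact ih hf.2 hg.2
      _ = _ := by ring

lemma norm_one_add_mul_I (u : ℝ) : ‖(1 : ℂ) + u * Complex.I‖ = √(1 + u ^ 2) := by
  rw [Complex.norm_def, Complex.normSq_apply]
  congr 1
  simp
  ring

lemma norm_one_add_mul_I_le_exp (u : ℝ) :
    ‖(1 : ℂ) + u * Complex.I‖ ≤ Real.exp (u ^ 2 / 2) := by
  rw [norm_one_add_mul_I, Real.sqrt_le_left (Real.exp_pos _).le, ← Real.exp_nat_mul]
  have := Real.add_one_le_exp (u ^ 2)
  convert (by linarith : 1 + u ^ 2 ≤ Real.exp (u ^ 2)) using 2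
  push_cast
  ring

lemma norm_one_add_mul_I_le (u : ℝ) : ‖(1 : ℂ) + u * Complex.I‖ ≤ 1 + |u| := by
  refine (norm_add_le _ _).trans ?_
  simp

/-- Both functions have norm at most one, which settles `|u| ≥ 1`; for smaller `u` their expansions
agree through second order. -/
lemma norm_exp_mul_I_sub_le (u : ℝ) :
    ‖Complex.exp (u * Complex.I) - (1 + u * Complex.I) * Real.exp (-u ^ 2 / 2)‖
      ≤ 2 * |u| ^ 3 := by
  have hbound : ‖(1 + u * Complex.I) * (Real.exp (-u ^ 2 / 2) : ℂ)‖ ≤ 1 := by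
    rw [norm_mul, Complex.norm_real, Real.norm_of_nonneg (Real.exp_pos _).le]
    calc _ ≤ Real.exp (u ^ 2 / 2) * Real.exp (-u ^ 2 / 2) := by
          gcongr; exact norm_one_add_mul_I_le_exp u
      _ = 1 := by rw [← Real.exp_add]; simp [neg_div]
  rcases le_total 1 |u| with hu | hu
  · have h1 : ‖Complex.exp (u * Complex.I)‖ = 1 := Complex.norm_exp_ofReal_mul_I u
    have h2 : 1 ≤ |u| ^ 3 := one_le_pow₀ hu
    linarith [norm_sub_le (Complex.exp (u * Complex.I))
      ((1 + u * Complex.I) * (Real.exp (-u ^ 2 / 2) : ℂ))]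
  · have h1 : ‖Complex.exp (u * Complex.I) - ∑ m ∈ Finset.range 3,
        (u * Complex.I) ^ m / (m.factorial : ℂ)‖ ≤ |u| ^ 3 * (2 / 9) := by
      have hn : ‖(u : ℂ) * Complex.I‖ = |u| := by simp
      have := Complex.exp_bound (x := u * Complex.I) (by rw [hn]; exact hu) (n := 3) (by norm_num)
      rw [hn] at this
      refine this.trans (le_of_eq ?_)
      norm_num [Nat.factorial]
    have h2 : |Real.exp (-u ^ 2 / 2) - 1 - (-u ^ 2 / 2)| ≤ (-u ^ 2 / 2) ^ 2 := by
      apply Real.abs_exp_sub_one_sub_id_le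
      have : u ^ 2 ≤ 1 := by rw [← sq_abs]; exact pow_le_one₀ (abs_nonneg _) hu
      rw [neg_div, abs_neg, abs_of_nonneg (by positivity)]
      linarith
    -- The middle term is what remains of `1 + iu - u²/2` after subtracting `(1 + iu)(1 - u²/2)`.
    have hsplit : Complex.exp (u * Complex.I) - (1 + u * Complex.I) * Real.exp (-u ^ 2 / 2)
        = (Complex.exp (u * Complex.I) - ∑ m ∈ Finset.range 3,
            (u * Complex.I) ^ m / (m.factorial : ℂ))
          + ((u ^ 3 / 2 : ℝ) : ℂ) * Complex.I
          - (1 + u * Complex.I) * ((Real.exp (-u ^ 2 / 2) - 1 - (-u ^ 2 / 2) : ℝ) : ℂ) := by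
      simp [Finset.sum_range_succ, Nat.factorial, mul_pow]
      ring
    rw [hsplit]
    have h3 : ‖((u ^ 3 / 2 : ℝ) : ℂ) * Complex.I‖ = |u| ^ 3 / 2 := by
      rw [norm_mul, Complex.norm_I, mul_one, Complex.norm_real, Real.norm_eq_abs, abs_div, abs_pow]
      norm_num
    have h4 : ‖(1 + u * Complex.I) * ((Real.exp (-u ^ 2 / 2) - 1 - (-u ^ 2 / 2) : ℝ) : ℂ)‖
        ≤ |u| ^ 3 / 2 := by
      rw [norm_mul, Complex.norm_real, Real.norm_eq_abs]
      calc _ ≤ (1 + |u|) * (-u ^ 2 / 2) ^ 2 := by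
            gcongr; exact norm_one_add_mul_I_le u
        _ ≤ 2 * (-u ^ 2 / 2) ^ 2 := by gcongr; linarith
        _ = |u| ^ 3 * |u| / 2 := by
            rw [show (-u ^ 2 / 2) ^ 2 = (u ^ 2) ^ 2 / 4 by ring, ← sq_abs u]; ring
        _ ≤ |u| ^ 3 * 1 / 2 := by gcongr
        _ = _ := by ring
    have h5 : 0 ≤ |u| ^ 3 := by positivity
    refine (norm_sub_le _ _).trans ?_
    refine (add_le_add_left (norm_add_le _ _) _).trans ?_
    rw [h3]
    linarith

/-- `xₖ` is kept as long as the sum of the squares of the earlier terms is at most `2`. -/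
def truncated (x : ℕ → ℝ) (k : ℕ) : ℝ :=
  if ∑ j ∈ Finset.range k, x j ^ 2 ≤ 2 then x k else 0

/-- The product `∏ (1 + i t zₖ)` over the truncated sequence `z`. -/
def charProd (t : ℝ) (x : ℕ → ℝ) (n : ℕ) : ℂ :=
  ∏ k ∈ Finset.range n, (1 + ((t * truncated x k : ℝ) : ℂ) * Complex.I)

lemma norm_charProd_le_exp (t : ℝ) (x : ℕ → ℝ) (n : ℕ)
    (h : ∑ j ∈ Finset.range n, x j ^ 2 ≤ 2) : ‖charProd t x n‖ ≤ Real.exp (t ^ 2) := by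
  have key : ‖charProd t x n‖ ≤ Real.exp (∑ k ∈ Finset.range n, (t * x k) ^ 2 / 2) := by
    rw [charProd, norm_prod, Real.exp_sum]
    refine Finset.prod_le_prod (fun _ _ => norm_nonneg _) fun k _ => ?_
    refine (norm_one_add_mul_I_le_exp _).trans (Real.exp_le_exp.2 ?_)
    unfold truncated
    split_ifs
    · exact le_rfl
    · simp; positivity
  refine key.trans (Real.exp_le_exp.2 ?_)
  have : ∑ k ∈ Finset.range n, (t * x k) ^ 2 / 2
      = t ^ 2 / 2 * ∑ k ∈ Finset.range n, x k ^ 2 := by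
    rw [Finset.mul_sum]; exact Finset.sum_congr rfl fun _ _ => by ring
  rw [this]
  nlinarith [sq_nonneg t]

/-- Until the sum of squares passes 2 the product is at most `exp (t²)`. The truncation lets through
only one more factor, the one that crosses the level, and it costs at most `1 + |t| D`. An
integrable `D` therefore suffices for integrability of the product. -/
lemma norm_charProd_le (t : ℝ) (x : ℕ → ℝ) (n : ℕ) {D : ℝ} (hD : 0 ≤ D)
    (hx : ∀ k < n, |x k| ≤ D) : ‖charProd t x n‖ ≤ Real.exp (t ^ 2) * (1 + |t| * D) := by
  have hone : 1 ≤ 1 + |t| * D := by have := mul_nonneg (abs_nonneg t) hD; linarith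
  induction n with
  | zero =>
    simp only [charProd, Finset.range_zero, Finset.prod_empty, norm_one]
    exact one_le_mul_of_one_le_of_one_le (Real.one_le_exp (sq_nonneg _)) hone
  | succ n ih =>
    rw [charProd, Finset.prod_range_succ, ← charProd, norm_mul]
    by_cases h : ∑ j ∈ Finset.range n, x j ^ 2 ≤ 2
    · gcongr
      · exact norm_charProd_le_exp t x n h
      · refine (norm_one_add_mul_I_le _).trans ?_
        rw [truncated, if_pos h, abs_mul]
        gcongr
        exact hx n n.lt_succ_self
    · rw [truncated, if_neg h]
      simpa using ih fun k hk => hx k (hk.trans n.lt_succ_self)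

lemma truncated_eq {x : ℕ → ℝ} {n : ℕ} (h : ∑ j ∈ Finset.range n, x j ^ 2 ≤ 2) {k : ℕ}
    (hk : k < n) : truncated x k = x k := by
  refine if_pos (le_trans ?_ h)
  exact Finset.sum_le_sum_of_subset_of_nonneg (Finset.range_mono hk.le) fun _ _ _ => sq_nonneg _

/-- Under `h` the truncation is inactive, and factors of norm at most one can be compared one by
one: the cubic errors add up to at most `2 |t|³ D ∑ xₖ²`. -/
lemma norm_exp_sum_sub_charProd_mul_le (t : ℝ) (x : ℕ → ℝ) (n : ℕ) {D : ℝ}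
    (hD : 0 ≤ D) (hx : ∀ k < n, |x k| ≤ D) (h : ∑ j ∈ Finset.range n, x j ^ 2 ≤ 2) :
    ‖Complex.exp (((t * ∑ k ∈ Finset.range n, x k : ℝ) : ℂ) * Complex.I)
      - charProd t x n * Real.exp (-(t ^ 2 * ∑ k ∈ Finset.range n, x k ^ 2) / 2)‖
      ≤ 4 * |t| ^ 3 * D := by
  have e1 : Complex.exp (((t * ∑ k ∈ Finset.range n, x k : ℝ) : ℂ) * Complex.I)
      = ∏ k ∈ Finset.range n, Complex.exp (((t * x k : ℝ) : ℂ) * Complex.I) := by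
    rw [← Complex.exp_sum, Finset.mul_sum]
    push_cast
    rw [Finset.sum_mul]
  have e2 : charProd t x n * Real.exp (-(t ^ 2 * ∑ k ∈ Finset.range n, x k ^ 2) / 2)
      = ∏ k ∈ Finset.range n, ((1 + ((t * x k : ℝ) : ℂ) * Complex.I)
          * Real.exp (-(t * x k) ^ 2 / 2)) := by
    rw [Finset.prod_mul_distrib, ← Complex.ofReal_prod, ← Real.exp_sum, charProd]
    congr 1
    · exact Finset.prod_congr rfl fun k hk => by rw [truncated_eq h (Finset.mem_range.1 hk)]
    · congr 2
      rw [Finset.mul_sum, ← Finset.sum_neg_distrib, Finset.sum_div]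
      exact Finset.sum_congr rfl fun _ _ => by ring
  rw [e1, e2]
  calc _ ≤ ∑ k ∈ Finset.range n, ‖Complex.exp (((t * x k : ℝ) : ℂ) * Complex.I)
          - (1 + ((t * x k : ℝ) : ℂ) * Complex.I) * Real.exp (-(t * x k) ^ 2 / 2)‖ := by
        refine norm_prod_sub_prod_le (fun k _ => (Complex.norm_exp_ofReal_mul_I _).le) fun k _ => ?_
        rw [norm_mul, Complex.norm_real, Real.norm_of_nonneg (Real.exp_pos _).le]
        calc _ ≤ Real.exp ((t * x k) ^ 2 / 2) * Real.exp (-(t * x k) ^ 2 / 2) := by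
              gcongr; exact norm_one_add_mul_I_le_exp _
          _ = 1 := by rw [← Real.exp_add]; simp [neg_div]
    _ ≤ ∑ k ∈ Finset.range n, 2 * |t| ^ 3 * D * x k ^ 2 := by
        refine Finset.sum_le_sum fun k hk => (norm_exp_mul_I_sub_le _).trans ?_
        rw [abs_mul, mul_pow, show |x k| ^ 3 = |x k| * x k ^ 2 by rw [← sq_abs (x k)]; ring]
        have := hx k (Finset.mem_range.1 hk)
        calc _ ≤ 2 * (|t| ^ 3 * (D * x k ^ 2)) := by gcongr
          _ = _ := by ring
    _ = 2 * |t| ^ 3 * D * ∑ k ∈ Finset.range n, x k ^ 2 := by rw [Finset.mul_sum]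
    _ ≤ 4 * |t| ^ 3 * D := by
        have : 0 ≤ |t| ^ 3 * D := by positivity
        nlinarith

/-- The constant in the error bound of `norm_exp_sum_sub_le`. -/
def errorConst (t : ℝ) : ℝ := 4 * |t| ^ 3 + Real.exp (t ^ 2) * (1 + |t| + t ^ 2) + 1

/-- If the sum of squares is within `ε` of one, it can be replaced by one in the exponent at a cost
of order `ε`. Otherwise the crude bound on the product is used, and the indicator pays for it. -/
lemma norm_exp_sum_sub_le (t : ℝ) (x : ℕ → ℝ) (n : ℕ) {D ε : ℝ} (hD : 0 ≤ D) (hε : 0 ≤ ε)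
    (hε1 : ε ≤ 1) (hx : ∀ k < n, |x k| ≤ D) :
    ‖Complex.exp (((t * ∑ k ∈ Finset.range n, x k : ℝ) : ℂ) * Complex.I)
      - charProd t x n * Real.exp (-t ^ 2 / 2)‖
      ≤ errorConst t * (D + ε + if ε ≤ |∑ k ∈ Finset.range n, x k ^ 2 - 1| then 1 else 0) := by
  have h0 : 0 ≤ |t| ^ 3 := by positivity
  have h1 : 0 < Real.exp (t ^ 2) := Real.exp_pos _
  have h2 : 0 ≤ |t| := abs_nonneg t
  split_ifs with h
  · have hexp : Real.exp (-t ^ 2 / 2) ≤ 1 := by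
      rw [Real.exp_le_one_iff]; have := sq_nonneg t; linarith
    refine (norm_sub_le _ _).trans ?_
    rw [Complex.norm_exp_ofReal_mul_I, norm_mul, Complex.norm_real,
      Real.norm_of_nonneg (Real.exp_pos _).le]
    have hT := norm_charProd_le t x n hD hx
    have h3 : ‖charProd t x n‖ * Real.exp (-t ^ 2 / 2) ≤ ‖charProd t x n‖ * 1 := by gcongr
    have h4 : 0 ≤ Real.exp (t ^ 2) * t ^ 2 := by positivity
    have h5 : 0 ≤ Real.exp (t ^ 2) * |t| := by positivity
    have hK : Real.exp (t ^ 2) * |t| ≤ errorConst t := by unfold errorConst; nlinarith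
    have hK1 : 1 + Real.exp (t ^ 2) ≤ errorConst t := by unfold errorConst; nlinarith
    have hK0 : 0 ≤ errorConst t := h5.trans hK
    nlinarith [mul_le_mul_of_nonneg_right hK hD, mul_nonneg hK0 hε]
  · push Not at h
    set A := ∑ k ∈ Finset.range n, x k ^ 2 with hA
    have hA0 : 0 ≤ A := Finset.sum_nonneg fun _ _ => sq_nonneg _
    have hA2 : A ≤ 2 := by have := abs_lt.1 h; linarith
    have hlip : |Real.exp (-(t ^ 2 * A) / 2) - Real.exp (-t ^ 2 / 2)| ≤ t ^ 2 / 2 * ε := by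
      -- The exponential is 1-Lipschitz on the nonpositive half-line.
      have key : ∀ a b : ℝ, a ≤ b → b ≤ 0 → Real.exp b - Real.exp a ≤ b - a := by
        intro a b hab hb
        have e : Real.exp a = Real.exp b * Real.exp (a - b) := by rw [← Real.exp_add]; ring_nf
        have := Real.add_one_le_exp (a - b)
        have hb1 : Real.exp b ≤ 1 := Real.exp_le_one_iff.2 hb
        have := Real.exp_pos b
        rw [e]
        nlinarith
      have ha : -(t ^ 2 * A) / 2 ≤ 0 := by have := mul_nonneg (sq_nonneg t) hA0; linarith
      have hb : -t ^ 2 / 2 ≤ 0 := by have := sq_nonneg t; linarith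
      have hd : |-(t ^ 2 * A) / 2 - -t ^ 2 / 2| ≤ t ^ 2 / 2 * ε := by
        rw [show -(t ^ 2 * A) / 2 - -t ^ 2 / 2 = -(t ^ 2 / 2) * (A - 1) by ring, abs_mul, abs_neg,
          abs_of_nonneg (by positivity : 0 ≤ t ^ 2 / 2)]
        gcongr
      refine le_trans ?_ hd
      rcases le_total (-(t ^ 2 * A) / 2) (-t ^ 2 / 2) with hab | hab
      · rw [abs_sub_comm, abs_sub_comm (-(t ^ 2 * A) / 2),
          abs_of_nonneg (sub_nonneg.2 (Real.exp_le_exp.2 hab)), abs_of_nonneg (sub_nonneg.2 hab)]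
        exact key _ _ hab hb
      · rw [abs_of_nonneg (sub_nonneg.2 (Real.exp_le_exp.2 hab)), abs_of_nonneg (sub_nonneg.2 hab)]
        exact key _ _ hab ha
    have e : Complex.exp (((t * ∑ k ∈ Finset.range n, x k : ℝ) : ℂ) * Complex.I)
        - charProd t x n * Real.exp (-t ^ 2 / 2)
        = (Complex.exp (((t * ∑ k ∈ Finset.range n, x k : ℝ) : ℂ) * Complex.I)
            - charProd t x n * Real.exp (-(t ^ 2 * A) / 2))
          + charProd t x n
            * ((Real.exp (-(t ^ 2 * A) / 2) - Real.exp (-t ^ 2 / 2) : ℝ) : ℂ) := by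
      push_cast; ring
    rw [e]
    refine (norm_add_le _ _).trans ?_
    have b1 := norm_exp_sum_sub_charProd_mul_le t x n hD hx hA2
    have b2 : ‖charProd t x n * ((Real.exp (-(t ^ 2 * A) / 2) - Real.exp (-t ^ 2 / 2) : ℝ) : ℂ)‖
        ≤ Real.exp (t ^ 2) * (t ^ 2 / 2 * ε) := by
      rw [norm_mul, Complex.norm_real, Real.norm_eq_abs]
      gcongr
      exact norm_charProd_le_exp t x n hA2
    refine (add_le_add b1 b2).trans ?_
    have h4 : 0 ≤ Real.exp (t ^ 2) * t ^ 2 := by positivity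
    have h5 : 0 ≤ Real.exp (t ^ 2) * |t| := by positivity
    have hK : 4 * |t| ^ 3 ≤ errorConst t := by unfold errorConst; nlinarith
    have hK1 : Real.exp (t ^ 2) * (t ^ 2 / 2) ≤ errorConst t := by unfold errorConst; nlinarith
    nlinarith [mul_le_mul_of_nonneg_right hK hD, mul_le_mul_of_nonneg_right hK1 hε]

variable {Ω : Type*} [m : MeasurableSpace Ω] {P : Measure Ω}

/-- `X` is a sequence of martingale differences for `𝒢`, where `Xₖ` is `𝒢ₖ₊₁`-measurable. -/
structure MartingaleDifference (P : Measure Ω) (𝒢 : Filtration ℕ m) (X : ℕ → Ω → ℝ) : Prop where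
  stronglyMeasurable : ∀ k, StronglyMeasurable[𝒢 (k + 1)] (X k)
  integrable : ∀ k, Integrable (X k) P
  condExp_ae_eq_zero : ∀ k, P[X k | 𝒢 k] =ᵐ[P] 0

namespace MartingaleDifference

variable {𝒢 : Filtration ℕ m} {X : ℕ → Ω → ℝ}

lemma stronglyMeasurable_of_lt (hX : MartingaleDifference P 𝒢 X) {j k : ℕ} (h : j < k) :
    StronglyMeasurable[𝒢 k] (X j) :=
  (hX.stronglyMeasurable j).mono (𝒢.mono h)

lemma stronglyMeasurable_sum_sq (hX : MartingaleDifference P 𝒢 X) (k : ℕ) :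
    StronglyMeasurable[𝒢 k] fun ω => ∑ j ∈ Finset.range k, X j ω ^ 2 :=
  Finset.stronglyMeasurable_fun_sum _ fun _ hj =>
    (hX.stronglyMeasurable_of_lt (Finset.mem_range.1 hj)).pow 2

lemma measurableSet_sum_sq_le (hX : MartingaleDifference P 𝒢 X) (k : ℕ) :
    MeasurableSet[𝒢 k] {ω | ∑ j ∈ Finset.range k, X j ω ^ 2 ≤ 2} :=
  (hX.stronglyMeasurable_sum_sq k).measurable measurableSet_Iic

lemma stronglyMeasurable_truncated (hX : MartingaleDifference P 𝒢 X) (k : ℕ) :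
    StronglyMeasurable[𝒢 (k + 1)] fun ω => truncated (fun j => X j ω) k :=
  StronglyMeasurable.ite (𝒢.mono k.le_succ _ (hX.measurableSet_sum_sq_le k))
    (hX.stronglyMeasurable k) stronglyMeasurable_const

lemma stronglyMeasurable_charProd (hX : MartingaleDifference P 𝒢 X) (t : ℝ) (n : ℕ) :
    StronglyMeasurable[𝒢 n] fun ω => charProd t (fun j => X j ω) n := by
  refine Finset.stronglyMeasurable_fun_prod _ fun k hk => ?_
  have h : StronglyMeasurable[𝒢 n] fun ω => truncated (fun j => X j ω) k :=
    (hX.stronglyMeasurable_truncated k).mono (𝒢.mono (Finset.mem_range.1 hk))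
  exact (show Continuous fun y : ℝ => 1 + ((t * y : ℝ) : ℂ) * Complex.I by
    fun_prop).comp_stronglyMeasurable h

lemma integral_mul_eq_zero [IsProbabilityMeasure P] (hX : MartingaleDifference P 𝒢 X) {k : ℕ}
    {f : Ω → ℂ} (hf : StronglyMeasurable[𝒢 k] f) {c : ℝ} (hc : ∀ ω, ‖f ω‖ ≤ c) :
    ∫ ω, f ω * X k ω ∂P = 0 := by
  have h := condExp_stronglyMeasurable_bilin_of_bound (μ := P)
    ((ContinuousLinearMap.lsmul ℝ ℝ : ℝ →L[ℝ] ℂ →L[ℝ] ℂ).flip) (𝒢.le k) hf (hX.integrable k) c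
    (ae_of_all _ hc)
  have e : (fun ω => f ω * X k ω)
      = fun ω => (ContinuousLinearMap.lsmul ℝ ℝ : ℝ →L[ℝ] ℂ →L[ℝ] ℂ).flip (f ω) (X k ω) := by
    ext ω; simp [mul_comm]
  rw [e, ← integral_condExp (𝒢.le k), integral_congr_ae h]
  refine integral_eq_zero_of_ae ?_
  filter_upwards [hX.condExp_ae_eq_zero k] with ω hω
  simp [hω]

lemma integrable_charProd [IsProbabilityMeasure P] (hX : MartingaleDifference P 𝒢 X) (t : ℝ)
    (n : ℕ) : Integrable (fun ω => charProd t (fun j => X j ω) n) P := by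
  have hint : Integrable (fun ω => Real.exp (t ^ 2)
      * (1 + |t| * ∑ k ∈ Finset.range n, |X k ω|)) P :=
    ((integrable_const _).add ((integrable_finsetSum _ fun k _ =>
      (hX.integrable k).abs).const_mul _)).const_mul _
  refine hint.mono' ((hX.stronglyMeasurable_charProd t n).mono (𝒢.le n)).aestronglyMeasurable
    (ae_of_all _ fun ω => norm_charProd_le t _ n (Finset.sum_nonneg fun _ _ => abs_nonneg _)
      fun k hk => ?_)
  exact Finset.single_le_sum (f := fun k => |X k ω|) (fun _ _ => abs_nonneg _)
    (Finset.mem_range.2 hk)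

/-- The truncation at time `n` is decided by the past, so each new factor has conditional
expectation one. -/
lemma integral_charProd [IsProbabilityMeasure P] (hX : MartingaleDifference P 𝒢 X) (t : ℝ)
    (n : ℕ) : ∫ ω, charProd t (fun j => X j ω) n ∂P = 1 := by
  induction n with
  | zero => simp [charProd]
  | succ n ih =>
    let s : Set Ω := {ω | ∑ j ∈ Finset.range n, X j ω ^ 2 ≤ 2}
    -- The product need not be bounded, but on `s` it is at most `exp (t²)`; off `s` the new factor
    -- is 1.
    let f : Ω → ℂ := s.indicator fun ω => t * Complex.I * charProd t (fun j => X j ω) n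
    have hf : StronglyMeasurable[𝒢 n] f :=
      ((hX.stronglyMeasurable_charProd t n).const_mul _).indicator (hX.measurableSet_sum_sq_le n)
    have hfb : ∀ ω, ‖f ω‖ ≤ |t| * Real.exp (t ^ 2) := by
      intro ω
      by_cases hω : ω ∈ s
      · simp only [f, Set.indicator_of_mem hω, norm_mul, Complex.norm_I, Complex.norm_real,
          Real.norm_eq_abs, mul_one]
        gcongr
        exact norm_charProd_le_exp t _ n hω
      · simp only [f, Set.indicator_of_notMem hω, norm_zero]
        positivity
    have e : ∀ ω, charProd t (fun j => X j ω) (n + 1)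
        = charProd t (fun j => X j ω) n + f ω * X n ω := by
      intro ω
      rw [charProd, Finset.prod_range_succ, ← charProd]
      by_cases hω : ω ∈ s
      · rw [truncated, if_pos (show ∑ j ∈ Finset.range n, X j ω ^ 2 ≤ 2 from hω), show f ω = _ from Set.indicator_of_mem hω _]
        push_cast; ring
      · rw [truncated, if_neg (show ¬∑ j ∈ Finset.range n, X j ω ^ 2 ≤ 2 from hω), show f ω = _ from Set.indicator_of_notMem hω _]
        simp
    have hint : Integrable (fun ω => f ω * X n ω) P :=
      (hX.integrable n).ofReal.bdd_mul (hf.mono (𝒢.le n)).aestronglyMeasurable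
        (ae_of_all _ hfb)
    simp_rw [e]
    rw [integral_add (hX.integrable_charProd t n) hint, ih, hX.integral_mul_eq_zero hf hfb,
      add_zero]

lemma norm_integral_exp_sub_le [IsProbabilityMeasure P] (hX : MartingaleDifference P 𝒢 X) (t : ℝ)
    (n : ℕ) {D : Ω → ℝ} (hD : Integrable D P) (hD0 : ∀ ω, 0 ≤ D ω)
    (hXD : ∀ k < n, ∀ ω, |X k ω| ≤ D ω) {ε : ℝ} (hε : 0 ≤ ε) (hε1 : ε ≤ 1) :
    ‖∫ ω, Complex.exp (((t * ∑ k ∈ Finset.range n, X k ω : ℝ) : ℂ) * Complex.I) ∂P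
      - Real.exp (-t ^ 2 / 2)‖
      ≤ errorConst t * (∫ ω, D ω ∂P + ε
        + P.real {ω | ε ≤ |∑ k ∈ Finset.range n, X k ω ^ 2 - 1|}) := by
  have hmeas : ∀ k, StronglyMeasurable (X k) := fun k => (hX.stronglyMeasurable k).mono (𝒢.le _)
  have hint : Integrable
      (fun ω => Complex.exp (((t * ∑ k ∈ Finset.range n, X k ω : ℝ) : ℂ) * Complex.I)) P := by
    refine Integrable.of_bound (C := 1) ?_ (ae_of_all _ fun ω =>
      (Complex.norm_exp_ofReal_mul_I _).le)
    exact ((show Continuous fun y : ℝ => Complex.exp (((t * y : ℝ) : ℂ) * Complex.I) by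
      fun_prop).comp_stronglyMeasurable
        (Finset.stronglyMeasurable_fun_sum _ fun k _ => hmeas k)).aestronglyMeasurable
  have hT := (hX.integrable_charProd t n).mul_const ((Real.exp (-t ^ 2 / 2) : ℝ) : ℂ)
  have e : ∫ ω, Complex.exp (((t * ∑ k ∈ Finset.range n, X k ω : ℝ) : ℂ) * Complex.I) ∂P
      - Real.exp (-t ^ 2 / 2)
      = ∫ ω, (Complex.exp (((t * ∑ k ∈ Finset.range n, X k ω : ℝ) : ℂ) * Complex.I)
        - charProd t (fun j => X j ω) n * Real.exp (-t ^ 2 / 2)) ∂P := by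
    rw [integral_sub hint hT, integral_mul_const, hX.integral_charProd, one_mul]
  have hs : MeasurableSet {ω | ε ≤ |∑ k ∈ Finset.range n, X k ω ^ 2 - 1|} := by
    have : StronglyMeasurable fun ω => |∑ k ∈ Finset.range n, X k ω ^ 2 - 1| :=
      ((Finset.stronglyMeasurable_fun_sum _ fun k _ => (hmeas k).pow 2).sub
        stronglyMeasurable_const).norm
    exact this.measurable measurableSet_Ici
  have hi : ∀ ω, (if ε ≤ |∑ k ∈ Finset.range n, X k ω ^ 2 - 1| then (1 : ℝ) else 0)
      = {ω | ε ≤ |∑ k ∈ Finset.range n, X k ω ^ 2 - 1|}.indicator 1 ω := by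
    intro ω; simp [Set.indicator]
  have hI : Integrable
      ({ω | ε ≤ |∑ k ∈ Finset.range n, X k ω ^ 2 - 1|}.indicator (1 : Ω → ℝ)) P :=
    (integrable_const _).indicator hs
  rw [e]
  refine (norm_integral_le_of_norm_le (((hD.add (integrable_const ε)).add hI).const_mul
    (errorConst t)) (ae_of_all _ fun ω => ?_)).trans (le_of_eq ?_)
  · simp only [Pi.add_apply, ← hi]
    exact norm_exp_sum_sub_le t _ n (hD0 ω) hε hε1 fun k hk => hXD k hk ω
  · rw [integral_const_mul, integral_add' (hD.add (integrable_const ε)) hI,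
      integral_add' hD (integrable_const ε), integral_indicator_one hs]
    simp

/-- Orthogonality of the increments; this bounds the second moment of the normalized score. -/
lemma integral_sum_sq [IsProbabilityMeasure P] (hX : MartingaleDifference P 𝒢 X)
    (hL2 : ∀ k, MemLp (X k) 2 P) (n : ℕ) :
    ∫ ω, (∑ k ∈ Finset.range n, X k ω) ^ 2 ∂P = ∑ k ∈ Finset.range n, ∫ ω, X k ω ^ 2 ∂P := by
  induction n with
  | zero => simp
  | succ n ih =>
    have hS : MemLp (fun ω => ∑ k ∈ Finset.range n, X k ω) 2 P :=
      memLp_finsetSum _ fun k _ => hL2 k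
    have hSm : StronglyMeasurable[𝒢 n] fun ω => ∑ k ∈ Finset.range n, X k ω :=
      Finset.stronglyMeasurable_fun_sum _ fun k hk =>
        hX.stronglyMeasurable_of_lt (Finset.mem_range.1 hk)
    have hSX : Integrable ((fun ω => ∑ k ∈ Finset.range n, X k ω) * X n) P :=
      hS.integrable_mul (hL2 n)
    have hcross : ∫ ω, (∑ k ∈ Finset.range n, X k ω) * X n ω ∂P = 0 := by
      have h := condExp_mul_of_stronglyMeasurable_left hSm hSX (hX.integrable n)
      change ∫ ω, ((fun ω => ∑ k ∈ Finset.range n, X k ω) * X n) ω ∂P = 0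
      rw [← integral_condExp (𝒢.le n), integral_congr_ae h]
      refine integral_eq_zero_of_ae ?_
      filter_upwards [hX.condExp_ae_eq_zero n] with ω hω
      simp [hω]
    have e : ∀ ω, (∑ k ∈ Finset.range (n + 1), X k ω) ^ 2
        = (∑ k ∈ Finset.range n, X k ω) ^ 2 + 2 * ((∑ k ∈ Finset.range n, X k ω) * X n ω)
          + X n ω ^ 2 := by
      intro ω; rw [Finset.sum_range_succ]; ring
    simp_rw [e]
    have h2 : Integrable (fun ω => 2 * ((∑ k ∈ Finset.range n, X k ω) * X n ω)) P :=
      hSX.const_mul 2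
    have h12 : Integrable (fun ω => (∑ k ∈ Finset.range n, X k ω) ^ 2
        + 2 * ((∑ k ∈ Finset.range n, X k ω) * X n ω)) P := hS.integrable_sq.add h2
    rw [integral_add h12 (hL2 n).integrable_sq, integral_add hS.integrable_sq h2,
      integral_const_mul, hcross, ih, Finset.sum_range_succ]
    simp

end MartingaleDifference

/-- **Martingale central limit theorem** for an array whose `n`th row is a martingale difference
sequence of length `n`. -/
theorem tendstoInDistribution_sum_of_martingaleDifference [IsProbabilityMeasure P]
    {𝒢 : ℕ → Filtration ℕ m} {X : ℕ → ℕ → Ω → ℝ}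
    (hX : ∀ n, MartingaleDifference P (𝒢 n) (X n))
    (hsq : TendstoInMeasure P (fun n ω => ∑ k ∈ Finset.range n, X n k ω ^ 2) atTop (fun _ => 1))
    {D : ℕ → Ω → ℝ} (hD : ∀ n, Integrable (D n) P) (hD0 : ∀ n ω, 0 ≤ D n ω)
    (hXD : ∀ n, ∀ k < n, ∀ ω, |X n k ω| ≤ D n ω)
    (hDlim : Tendsto (fun n => ∫ ω, D n ω ∂P) atTop (𝓝 0)) :
    TendstoInDistribution (fun n ω => ∑ k ∈ Finset.range n, X n k ω) atTop id (fun _ => P)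
      (gaussianReal 0 1) := by
  have hmeas : ∀ n, AEMeasurable (fun ω => ∑ k ∈ Finset.range n, X n k ω) P := fun n =>
    (integrable_finsetSum _ fun k _ => (hX n).integrable k).aemeasurable
  refine ⟨hmeas, aemeasurable_id, ?_⟩
  refine ProbabilityMeasure.tendsto_iff_tendsto_charFun.2 fun t => ?_
  simp only [ProbabilityMeasure.coe_mk, Measure.map_id]
  have hlim : charFun (gaussianReal 0 1) t = ((Real.exp (-t ^ 2 / 2) : ℝ) : ℂ) := by
    rw [charFun_gaussianReal]
    push_cast
    congr 1
    simp
    ring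
  have hchar : ∀ n, charFun (P.map fun ω => ∑ k ∈ Finset.range n, X n k ω) t
      = ∫ ω, Complex.exp (((t * ∑ k ∈ Finset.range n, X n k ω : ℝ) : ℂ) * Complex.I) ∂P := by
    intro n
    rw [charFun_apply_real, integral_map (hmeas n) (by fun_prop)]
    push_cast
    rfl
  simp_rw [hlim, hchar]
  rw [tendsto_iff_norm_sub_tendsto_zero, Metric.tendsto_nhds]
  intro δ hδ
  have hK : 0 < errorConst t := by unfold errorConst; positivity
  -- Three error terms of at most `ε` each then contribute at most `3 δ / 4`.
  set ε : ℝ := min 1 (δ / (4 * errorConst t)) with hε_def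
  have hε : 0 < ε := by positivity
  have hεK : errorConst t * ε ≤ δ / 4 := by
    calc _ ≤ errorConst t * (δ / (4 * errorConst t)) := by gcongr; exact min_le_right _ _
      _ = δ / 4 := by field_simp
  have hp := tendstoInMeasure_iff_measureReal_norm.1 hsq ε hε
  filter_upwards [hDlim.eventually_lt_const hε, hp.eventually_lt_const hε] with n h1 h2
  rw [Real.dist_eq, sub_zero, abs_of_nonneg (norm_nonneg _)]
  refine ((hX n).norm_integral_exp_sub_le t n (hD n) (hD0 n) (hXD n) hε.le
    (min_le_left _ _)).trans_lt ?_
  have h3 : ∫ ω, D n ω ∂P + ε + P.real {ω | ε ≤ |∑ k ∈ Finset.range n, X n k ω ^ 2 - 1|}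
      ≤ 3 * ε := by
    simp only [Real.norm_eq_abs] at h2
    linarith
  nlinarith [mul_le_mul_of_nonneg_left h3 hK.le]

end MartingaleCLT

/-! ### From finite martingales to difference sequences indexed by the naturals -/

section FinMartingale

section Extension

variable {Ω : Type*} {n : ℕ}

/-- The extension by zero of a finite sequence. -/
def extendZero (y : Fin n → Ω → ℝ) (k : ℕ) (ω : Ω) : ℝ := if h : k < n then y ⟨k, h⟩ ω else 0

lemma extendZero_of_lt (y : Fin n → Ω → ℝ) {k : ℕ} (h : k < n) :
    extendZero y k = y ⟨k, h⟩ := by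
  ext ω; exact dif_pos h

lemma extendZero_of_not_lt (y : Fin n → Ω → ℝ) {k : ℕ} (h : ¬k < n) : extendZero y k = 0 := by
  ext ω; exact dif_neg h

lemma sum_range_extendZero (y : Fin n → Ω → ℝ) (g : ℝ → ℝ) (ω : Ω) :
    ∑ k ∈ Finset.range n, g (extendZero y k ω) = ∑ i, g (y i ω) := by
  rw [Finset.sum_range]
  exact Finset.sum_congr rfl fun i _ => by rw [extendZero_of_lt y i.2]

lemma sum_Iic_succ (y : Fin n → ℝ) {k : ℕ} (h : k + 1 < n) :
    ∑ i ∈ Finset.Iic (⟨k + 1, h⟩ : Fin n), y i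
      = ∑ i ∈ Finset.Iic (⟨k, k.lt_succ_self.trans h⟩ : Fin n), y i + y ⟨k + 1, h⟩ := by
  have e : Finset.Iic (⟨k + 1, h⟩ : Fin n)
      = insert ⟨k + 1, h⟩ (Finset.Iic (⟨k, k.lt_succ_self.trans h⟩ : Fin n)) := by
    ext i
    simp only [Finset.mem_Iic, Finset.mem_insert, Fin.le_def, Fin.ext_iff]
    omega
  rw [e, Finset.sum_insert (by simp), add_comm]

lemma sum_Iic_zero (y : Fin n → ℝ) (h : 0 < n) :
    ∑ i ∈ Finset.Iic (⟨0, h⟩ : Fin n), y i = y ⟨0, h⟩ := by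
  have e : Finset.Iic (⟨0, h⟩ : Fin n) = {⟨0, h⟩} := by
    ext i
    simp only [Finset.mem_Iic, Finset.mem_singleton, Fin.le_def, Fin.ext_iff]
    omega
  rw [e, Finset.sum_singleton]

end Extension

variable {Ω : Type*} [m : MeasurableSpace Ω] {P : Measure Ω} {n : ℕ}

/-- The extension of a filtration indexed by `Fin n` to a filtration indexed by `ℕ`, shifted by one
so that it starts with the trivial `σ`-algebra. -/
def extendFiltration (ℱ : Filtration (Fin n) m) : Filtration ℕ m where
  seq k := match k with
    | 0 => ⊥
    | k + 1 => if h : k < n then ℱ ⟨k, h⟩ else m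
  mono' := by
    refine monotone_nat_of_le_succ fun k => ?_
    rcases k with _ | k
    · exact bot_le
    · by_cases h : k + 1 < n
      · simp only [h, (Nat.lt_succ_self k).trans h, dif_pos]
        exact ℱ.mono (Fin.mk_le_mk.2 k.le_succ)
      · by_cases h' : k < n
        · simpa only [h, h', dif_pos, dif_neg, not_false_eq_true] using ℱ.le _
        · simp only [h, h', dif_neg, not_false_eq_true, le_refl]
  le' k := by
    rcases k with _ | k
    · exact bot_le
    · by_cases h : k < n
      · simpa only [h, dif_pos] using ℱ.le _
      · simp only [h, dif_neg, not_false_eq_true, le_refl]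

lemma extendFiltration_succ (ℱ : Filtration (Fin n) m) {k : ℕ} (h : k < n) :
    extendFiltration ℱ (k + 1) = ℱ ⟨k, h⟩ :=
  dif_pos h

lemma martingaleDifference_extendZero [IsProbabilityMeasure P] {ℱ : Filtration (Fin n) m}
    {Y : Fin n → Ω → ℝ} (hY : ∀ i, Integrable (Y i) P)
    (hmart : Martingale (fun (j : Fin n) ω => ∑ i ∈ Finset.Iic j, Y i ω) ℱ P)
    (hmean : ∀ i, ∫ ω, Y i ω ∂P = 0) (c : ℝ) :
    MartingaleDifference P (extendFiltration ℱ) (extendZero fun i ω => c * Y i ω) where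
  stronglyMeasurable k := by
    by_cases h : k < n
    · rw [extendZero_of_lt _ h, extendFiltration_succ ℱ h]
      refine StronglyMeasurable.const_mul ?_ c
      rcases k with _ | k
      · simpa only [sum_Iic_zero] using hmart.stronglyAdapted ⟨0, h⟩
      · have h1 := hmart.stronglyAdapted ⟨k + 1, h⟩
        have h2 := (hmart.stronglyAdapted ⟨k, k.lt_succ_self.trans h⟩).mono
          (ℱ.mono (show (⟨k, k.lt_succ_self.trans h⟩ : Fin n) ≤ ⟨k + 1, h⟩ from k.le_succ))
        convert h1.sub h2 using 1
        ext ω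
        simp [sum_Iic_succ _ h]
    · rw [extendZero_of_not_lt _ h]
      exact stronglyMeasurable_zero
  integrable k := by
    by_cases h : k < n
    · rw [extendZero_of_lt _ h]
      exact (hY _).const_mul c
    · rw [extendZero_of_not_lt _ h]
      exact integrable_zero _ _ _
  condExp_ae_eq_zero k := by
    by_cases h : k < n
    · rw [extendZero_of_lt _ h]
      refine (condExp_smul c (Y ⟨k, h⟩) _).trans ?_
      suffices hz : P[Y ⟨k, h⟩ | extendFiltration ℱ k] =ᵐ[P] 0 by
        filter_upwards [hz] with ω hω
        simp [hω]
      rcases k with _ | k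
      -- The martingale property says nothing about the first term; conditioning on the trivial
      -- `σ`-algebra turns the requirement into zero mean.
      · rw [show extendFiltration ℱ 0 = ⊥ from rfl, condExp_bot, hmean]
        rfl
      · have hk := k.lt_succ_self.trans h
        rw [extendFiltration_succ ℱ hk]
        have e : Y ⟨k + 1, h⟩ = (fun ω => ∑ i ∈ Finset.Iic (⟨k + 1, h⟩ : Fin n), Y i ω)
            - fun ω => ∑ i ∈ Finset.Iic (⟨k, hk⟩ : Fin n), Y i ω := by
          ext ω
          simp [sum_Iic_succ _ h]
        rw [e]
        refine (condExp_sub (hmart.integrable _) (hmart.integrable _) _).trans ?_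
        have h1 := hmart.condExp_ae_eq
          (show (⟨k, hk⟩ : Fin n) ≤ ⟨k + 1, h⟩ from k.le_succ)
        have h2 := hmart.condExp_ae_eq (le_refl (⟨k, hk⟩ : Fin n))
        filter_upwards [h1, h2] with ω hω1 hω2
        simp [hω1, hω2]
    · rw [extendZero_of_not_lt _ h, condExp_zero]

end FinMartingale

/-! ### Measurable selection of a closest root -/

section RootSelection

variable {Ω : Type*} [m : MeasurableSpace Ω]

/-- Existence of a root becomes a countable condition, hence a measurable event for a random
function: `|g|` attains its minimum on the compact interval, and the points `q * t` with rational
`q` are dense in it. -/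
lemma exists_root_Icc_iff {g : ℝ → ℝ} {t : ℝ} (ht : 0 ≤ t) (hg : ContinuousOn g (Set.Icc 0 t)) :
    (∃ s ∈ Set.Icc 0 t, g s = 0)
      ↔ ∀ k : ℕ, ∃ q : ℚ, q ∈ Set.Icc (0 : ℚ) 1 ∧ |g (q * t)| < 1 / (k + 1 : ℝ) := by
  constructor
  · rintro ⟨s, hs, hs0⟩ k
    have hc : ContinuousOn (fun u : ℝ => |g (u * t)|) (Set.Icc 0 1) := by
      refine (hg.comp (by fun_prop) fun u hu => ?_).abs
      exact ⟨mul_nonneg hu.1 ht, mul_le_of_le_one_left ht hu.2⟩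
    obtain ⟨u, hu, hus⟩ : ∃ u ∈ Set.Icc (0 : ℝ) 1, u * t = s := by
      rcases ht.eq_or_lt with rfl | htpos
      · exact ⟨0, by simp, by linarith [hs.1, hs.2]⟩
      · exact ⟨s / t, ⟨div_nonneg hs.1 ht, (div_le_one htpos).2 hs.2⟩, by field_simp⟩
    have hnhds : ∀ᶠ v in 𝓝[Set.Icc 0 1] u, |g (v * t)| < 1 / (k + 1 : ℝ) := by
      have hlim := hc u hu
      refine hlim.eventually_lt_const ?_
      simp only [hus, hs0, abs_zero]
      positivity
    obtain ⟨O, hO, huO, hsub⟩ := mem_nhdsWithin.1 hnhds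
    -- The root may sit at an endpoint, so a rational is sought near it in the open interval.
    have hcl : u ∈ closure (Set.Ioo (0 : ℝ) 1) := by
      rwa [closure_Ioo (by norm_num)]
    obtain ⟨v, hvO, hv⟩ := mem_closure_iff.1 hcl O hO huO
    obtain ⟨q, hq⟩ := Rat.denseRange_cast.exists_mem_open (hO.inter isOpen_Ioo) ⟨v, hvO, hv⟩
    refine ⟨q, ⟨by exact_mod_cast hq.2.1.le, by exact_mod_cast hq.2.2.le⟩, ?_⟩
    exact hsub ⟨hq.1, Set.Ioo_subset_Icc_self hq.2⟩
  · intro h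
    obtain ⟨s, hs, hmin⟩ := isCompact_Icc.exists_isMinOn ⟨0, Set.left_mem_Icc.2 ht⟩ hg.abs
    refine ⟨s, hs, ?_⟩
    by_contra hne
    obtain ⟨k, hk⟩ := exists_nat_one_div_lt (abs_pos.2 hne)
    obtain ⟨q, hq, hlt⟩ := h k
    have hq' : (q : ℝ) * t ∈ Set.Icc 0 t :=
      ⟨mul_nonneg (by exact_mod_cast hq.1) ht,
        mul_le_of_le_one_left ht (by exact_mod_cast hq.2)⟩
    exact absurd (hmin hq') (not_le.2 (hlt.trans hk))

/-- The smallest root in `[0, δ)` of a random function can be chosen measurably; the value `δ`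
stands for the absence of roots. -/
lemma exists_measurable_least_root {g : Ω → ℝ → ℝ} {δ : ℝ} (hδ : 0 < δ)
    (hmeas : ∀ t ∈ Set.Ico 0 δ, Measurable fun ω => g ω t) {G : Set Ω} (hG : MeasurableSet G)
    (hcont : ∀ ω ∈ G, ContinuousOn (g ω) (Set.Ico 0 δ)) :
    ∃ r : Ω → ℝ, Measurable r ∧ (∀ ω, 0 ≤ r ω) ∧
      (∀ ω, r ω < δ → g ω (r ω) = 0) ∧
      ∀ ω ∈ G, ∀ t ∈ Set.Ico 0 δ, g ω t = 0 → r ω ≤ t := by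
  classical
  let p : Ω → Prop := fun ω => ω ∈ G ∧ ∃ t ∈ Set.Ico 0 δ, g ω t = 0
  have hleast : ∀ ω, p ω → ∃ r, r ∈ Set.Ico 0 δ ∧ g ω r = 0 ∧
      ∀ t ∈ Set.Ico 0 δ, g ω t = 0 → r ≤ t := by
    rintro ω ⟨hω, t, ht, ht0⟩
    have hsub : Set.Icc 0 t ⊆ Set.Ico 0 δ := fun s hs => ⟨hs.1, hs.2.trans_lt ht.2⟩
    -- The half-open interval is not compact; a least root is found among those not exceeding a
    -- known root `t`.
    have hK : IsCompact (Set.Icc 0 t ∩ g ω ⁻¹' {0}) := by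
      refine isCompact_Icc.of_isClosed_subset ?_ Set.inter_subset_left
      exact ((hcont ω hω).mono hsub).preimage_isClosed_of_isClosed isClosed_Icc isClosed_singleton
    obtain ⟨r, hr, hmin⟩ := hK.exists_isLeast ⟨t, ⟨ht.1, le_rfl⟩, ht0⟩
    refine ⟨r, hsub hr.1, hr.2, fun s hs hs0 => ?_⟩
    rcases le_total s t with hst | hst
    · exact hmin ⟨⟨hs.1, hst⟩, hs0⟩
    · exact hr.1.2.trans hst
  let r : Ω → ℝ := fun ω => if h : p ω then (hleast ω h).choose else δ
  have hr_pos : ∀ ω (h : p ω), r ω ∈ Set.Ico 0 δ ∧ g ω (r ω) = 0 ∧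
      ∀ t ∈ Set.Ico 0 δ, g ω t = 0 → r ω ≤ t := by
    intro ω h
    rw [show r ω = _ from dif_pos h]
    exact (hleast ω h).choose_spec
  have hr_neg : ∀ ω, ¬p ω → r ω = δ := fun ω h => dif_neg h
  refine ⟨r, ?_, fun ω => ?_, fun ω hω => ?_, fun ω hω t ht ht0 => ?_⟩
  · refine measurable_of_Iic fun t => ?_
    rcases lt_or_ge t 0 with ht | ht
    · convert MeasurableSet.empty
      ext ω
      simp only [Set.mem_preimage, Set.mem_Iic, Set.mem_empty_iff_false, iff_false, not_le]
      by_cases h : p ω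
      · exact ht.trans_le (hr_pos ω h).1.1
      · rw [hr_neg ω h]; exact ht.trans hδ
    rcases le_or_gt δ t with htδ | htδ
    · convert MeasurableSet.univ
      ext ω
      simp only [Set.mem_preimage, Set.mem_Iic, Set.mem_univ, iff_true]
      by_cases h : p ω
      · exact (hr_pos ω h).1.2.le.trans htδ
      · rw [hr_neg ω h]; exact htδ
    -- For `0 ≤ t < δ`, `r ω ≤ t` means that `ω ∈ G` and there is a root in `[0, t]`.
    have e : r ⁻¹' Set.Iic t = G ∩ ⋂ k : ℕ, ⋃ q : ℚ, ⋃ _ : q ∈ Set.Icc (0 : ℚ) 1,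
        {ω | |g ω (q * t)| < 1 / (k + 1 : ℝ)} := by
      ext ω
      simp only [Set.mem_preimage, Set.mem_Iic, Set.mem_inter_iff, Set.mem_iInter, Set.mem_iUnion,
        Set.mem_ofPred_eq, exists_prop]
      constructor
      · intro h
        have hp : p ω := by
          by_contra hp
          rw [hr_neg ω hp] at h
          exact absurd h (not_le.2 htδ)
        obtain ⟨h1, h2, -⟩ := hr_pos ω hp
        refine ⟨hp.1, ?_⟩
        rw [← exists_root_Icc_iff ht ((hcont ω hp.1).mono fun s hs => ⟨hs.1, hs.2.trans_lt htδ⟩)]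
        exact ⟨r ω, ⟨h1.1, h⟩, h2⟩
      · rintro ⟨hω, h⟩
        rw [← exists_root_Icc_iff ht
          ((hcont ω hω).mono fun s hs => ⟨hs.1, hs.2.trans_lt htδ⟩)] at h
        obtain ⟨s, hs, hs0⟩ := h
        have hs' : s ∈ Set.Ico 0 δ := ⟨hs.1, hs.2.trans_lt htδ⟩
        exact ((hr_pos ω ⟨hω, s, hs', hs0⟩).2.2 s hs' hs0).trans hs.2
    rw [e]
    refine hG.inter (MeasurableSet.iInter fun k => MeasurableSet.iUnion fun q =>
      MeasurableSet.iUnion fun hq => ?_)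
    have hm : Measurable fun ω => g ω (q * t) := hmeas _
      ⟨mul_nonneg (by exact_mod_cast hq.1) ht,
        (mul_le_of_le_one_left ht (by exact_mod_cast hq.2)).trans_lt htδ⟩
    exact measurableSet_lt hm.abs measurable_const
  · by_cases h : p ω
    · exact (hr_pos ω h).1.1
    · rw [hr_neg ω h]; exact hδ.le
  · by_cases h : p ω
    · exact (hr_pos ω h).2.1
    · rw [hr_neg ω h] at hω
      exact absurd hω (lt_irrefl _)
  · exact (hr_pos ω ⟨hω, t, ht, ht0⟩).2.2 t ht ht0

/-- A root of a random function that is closest to `β₀` among the roots in a ball around `β₀` can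
be chosen measurably. -/
lemma exists_measurable_closest_root {f : Ω → ℝ → ℝ} {β₀ δ : ℝ} (hδ : 0 < δ)
    (hmeas : ∀ β ∈ Metric.ball β₀ δ, Measurable fun ω => f ω β) {G : Set Ω} (hG : MeasurableSet G)
    (hcont : ∀ ω ∈ G, ContinuousOn (f ω) (Metric.ball β₀ δ)) :
    ∃ b : Ω → ℝ, Measurable b ∧ (∀ ω, b ω ∈ Metric.ball β₀ δ) ∧
      ∀ ω ∈ G, ∀ β ∈ Metric.ball β₀ δ, f ω β = 0 →
        f ω (b ω) = 0 ∧ |b ω - β₀| ≤ |β - β₀| := by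
  have hmem : ∀ c : ℝ, |c| = 1 → ∀ t ∈ Set.Ico 0 δ, β₀ + c * t ∈ Metric.ball β₀ δ := by
    intro c hc t ht
    rw [Metric.mem_ball, Real.dist_eq, add_sub_cancel_left, abs_mul, hc, one_mul,
      abs_of_nonneg ht.1]
    exact ht.2
  have key : ∀ c : ℝ, |c| = 1 → _ := fun c hc =>
    exists_measurable_least_root (g := fun ω t => f ω (β₀ + c * t)) hδ
      (fun t ht => hmeas _ (hmem c hc t ht)) hG
      (fun ω hω => (hcont ω hω).comp (by fun_prop) (hmem c hc))
  -- `r` and `l` are the distances to the nearest root on the right and on the left of `β₀`; when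
  -- neither is below `δ`, the default `β₀` keeps `b` in the ball.
  obtain ⟨r, hr, hr0, hroot, hmin⟩ := key 1 (by simp)
  obtain ⟨l, hl, hl0, hroot', hmin'⟩ := key (-1) (by simp)
  let b : Ω → ℝ := fun ω =>
    if min (r ω) (l ω) < δ then (if r ω ≤ l ω then β₀ + 1 * r ω else β₀ + -1 * l ω) else β₀
  have hb : ∀ ω, min (r ω) (l ω) < δ → f ω (b ω) = 0 ∧ |b ω - β₀| = min (r ω) (l ω) := by
    intro ω h
    by_cases hrl : r ω ≤ l ω
    · have e : b ω = β₀ + 1 * r ω := by simp only [b, if_pos h, if_pos hrl]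
      rw [min_eq_left hrl] at h ⊢
      rw [e]
      exact ⟨hroot ω h, by simp [hr0 ω]⟩
    · have e : b ω = β₀ + -1 * l ω := by simp only [b, if_pos h, if_neg hrl]
      rw [min_eq_right (not_le.1 hrl).le] at h ⊢
      rw [e]
      exact ⟨hroot' ω h, by simp [hl0 ω]⟩
  refine ⟨b, ?_, fun ω => ?_, fun ω hω β hβ hβ0 => ?_⟩
  · exact Measurable.ite (measurableSet_lt (hr.min hl) measurable_const)
      (Measurable.ite (measurableSet_le hr hl) (by fun_prop) (by fun_prop)) measurable_const
  · rw [Metric.mem_ball, Real.dist_eq]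
    by_cases h : min (r ω) (l ω) < δ
    · rw [(hb ω h).2]; exact h
    · have e : b ω = β₀ := if_neg h
      simpa [e] using hδ
  · rw [Metric.mem_ball, Real.dist_eq] at hβ
    have hle : min (r ω) (l ω) ≤ |β - β₀| := by
      rcases le_total β₀ β with h | h
      · rw [abs_of_nonneg (sub_nonneg.2 h)] at hβ ⊢
        exact (min_le_left _ _).trans
          (hmin ω hω _ ⟨sub_nonneg.2 h, hβ⟩ (by simpa using hβ0))
      · rw [abs_of_nonpos (sub_nonpos.2 h)] at hβ ⊢
        exact (min_le_right _ _).trans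
          (hmin' ω hω _ ⟨by linarith, hβ⟩ (by simpa using hβ0))
    obtain ⟨h1, h2⟩ := hb ω (hle.trans_lt hβ)
    exact ⟨h1, h2.trans_le hle⟩

end RootSelection

/-! ### Taylor bound and sign change for a fixed function -/

section DeterministicBounds

/-- The mean value inequality is applied twice, so `f₂` need not be continuous or integrable; the
lost factor `1/2` is immaterial. -/
lemma abs_sub_sub_mul_le_of_hasDerivAt {f f₁ f₂ : ℝ → ℝ} {β₀ δ M : ℝ} (hδ : 0 < δ)
    (h₁ : ∀ β ∈ Metric.ball β₀ δ, HasDerivAt f (f₁ β) β)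
    (h₂ : ∀ β ∈ Metric.ball β₀ δ, HasDerivAt f₁ (f₂ β) β)
    (hM : ∀ β ∈ Metric.ball β₀ δ, |f₂ β| ≤ M) {β : ℝ} (hβ : β ∈ Metric.ball β₀ δ) :
    |f β - f β₀ - f₁ β₀ * (β - β₀)| ≤ M * (β - β₀) ^ 2 := by
  have h0 : β₀ ∈ Metric.ball β₀ δ := Metric.mem_ball_self hδ
  have hM0 : 0 ≤ M := (abs_nonneg _).trans (hM β₀ h0)
  have hslope : ∀ b ∈ Metric.ball β₀ δ, |f₁ b - f₁ β₀| ≤ M * |b - β₀| := fun b hb =>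
    (convex_ball β₀ δ).norm_image_sub_le_of_norm_hasDerivWithin_le
      (fun x hx => (h₂ x hx).hasDerivWithinAt) hM h0 hb
  have hsub : Metric.closedBall β₀ |β - β₀| ⊆ Metric.ball β₀ δ :=
    Metric.closedBall_subset_ball hβ
  have hd : ∀ b ∈ Metric.closedBall β₀ |β - β₀|,
      HasDerivWithinAt (fun b => f b - f₁ β₀ * (b - β₀)) (f₁ b - f₁ β₀)
        (Metric.closedBall β₀ |β - β₀|) b := by
    intro b hb
    have := (h₁ b (hsub hb)).sub (((hasDerivAt_id b).sub_const β₀).const_mul (f₁ β₀))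
    rw [mul_one] at this
    exact this.hasDerivWithinAt
  have := (convex_closedBall β₀ |β - β₀|).norm_image_sub_le_of_norm_hasDerivWithin_le
    (C := M * |β - β₀|) hd
    (fun b hb => (hslope b (hsub hb)).trans
      (mul_le_mul_of_nonneg_left (by simpa [Real.dist_eq] using hb) hM0))
    (Metric.mem_closedBall_self (abs_nonneg _))
    (show β ∈ Metric.closedBall β₀ |β - β₀| by simp [Real.dist_eq])
  simp only [Real.norm_eq_abs, sub_self, mul_zero, sub_zero] at this
  calc _ = |f β - f₁ β₀ * (β - β₀) - f β₀| := by congr 1; ring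
    _ ≤ M * |β - β₀| * |β - β₀| := this
    _ = M * (β - β₀) ^ 2 := by rw [mul_assoc, abs_mul_abs_self]; ring

/-- By `hle` the linear term dominates at both endpoints, so `F` is nonpositive on the left and
nonnegative on the right. -/
lemma exists_root_of_abs_sub_le {F : ℝ → ℝ} {β₀ s d μ c : ℝ} (hc : 0 ≤ c)
    (hcont : ContinuousOn F (Metric.closedBall β₀ c))
    (hF : ∀ β ∈ Metric.closedBall β₀ c, |F β - s - d * (β - β₀)| ≤ μ * (β - β₀) ^ 2)
    (hle : |s| + μ * c ^ 2 ≤ d * c) : ∃ β ∈ Metric.closedBall β₀ c, F β = 0 := by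
  rw [Real.closedBall_eq_Icc] at *
  have hl := hF (β₀ - c) ⟨le_rfl, by linarith⟩
  have hr := hF (β₀ + c) ⟨by linarith, le_rfl⟩
  have hs := abs_le.1 (le_refl |s|)
  rw [abs_le] at hl hr
  ring_nf at hl hr hle
  obtain ⟨β, hβ, h0⟩ := intermediate_value_Icc (by linarith : β₀ - c ≤ β₀ + c) hcont
    (show (0 : ℝ) ∈ Set.Icc (F (β₀ - c)) (F (β₀ + c)) from
      ⟨by linarith [hl.2], by linarith [hr.1]⟩)
  exact ⟨β, hβ, h0⟩

end DeterministicBounds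

/-! ### Stochastic order calculus -/

section InProbability

variable {Ω : Type*} [MeasurableSpace Ω] {P : Measure Ω} [IsProbabilityMeasure P]

lemma boundedInProbability_iff_measureReal {X : ℕ → Ω → ℝ} : BoundedInProbability P X ↔
    ∀ ε : ℝ, 0 < ε → ∃ C : ℝ, ∀ᶠ n in atTop, P.real {ω | C < |X n ω|} ≤ ε := by
  refine forall_congr' fun ε => forall_congr' fun hε => exists_congr fun C =>
    eventually_congr (Eventually.of_forall fun n => ?_)
  rw [ENNReal.le_ofReal_iff_toReal_le (measure_ne_top _ _) hε.le]
  rfl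

lemma measureReal_le_abs_le {Ω : Type*} [MeasurableSpace Ω] {P : Measure Ω} [IsFiniteMeasure P] {Y : Ω → ℝ} (hY : MemLp Y 2 P) {ε : ℝ} (hε : 0 < ε) :
    P.real {ω | ε ≤ |Y ω|} ≤ (∫ ω, Y ω ^ 2 ∂P) / ε ^ 2 := by
  rw [le_div_iff₀ (by positivity), mul_comm]
  have e : {ω | ε ≤ |Y ω|} = {ω | ε ^ 2 ≤ Y ω ^ 2} := by
    ext ω
    simp only [Set.mem_ofPred_eq]
    rw [← sq_abs (Y ω), sq_le_sq₀ hε.le (abs_nonneg _)]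
  rw [e]
  exact mul_meas_ge_le_integral_of_nonneg (ae_of_all _ fun _ => sq_nonneg _) hY.integrable_sq _

lemma tendstoInMeasure_zero_of_integral_sq {Y : ℕ → Ω → ℝ} (hY : ∀ n, MemLp (Y n) 2 P)
    (h : Tendsto (fun n => ∫ ω, Y n ω ^ 2 ∂P) atTop (𝓝 0)) :
    TendstoInMeasure P Y atTop fun _ => 0 := by
  refine tendstoInMeasure_iff_measureReal_norm.2 fun ε hε => ?_
  simp only [sub_zero, Real.norm_eq_abs]
  refine squeeze_zero (fun _ => measureReal_nonneg) (fun n => measureReal_le_abs_le (hY n) hε) ?_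
  simpa using h.div_const (ε ^ 2)

lemma boundedInProbability_of_integral_sq_le {Y : ℕ → Ω → ℝ} (hY : ∀ n, MemLp (Y n) 2 P)
    (h : ∀ n, ∫ ω, Y n ω ^ 2 ∂P ≤ 1) : BoundedInProbability P Y := by
  refine boundedInProbability_iff_measureReal.2 fun ε hε => ?_
  refine ⟨√(1 / ε), Eventually.of_forall fun n => ?_⟩
  have hs : 0 < √(1 / ε) := by positivity
  calc P.real {ω | √(1 / ε) < |Y n ω|}
    _ ≤ P.real {ω | √(1 / ε) ≤ |Y n ω|} :=
        measureReal_mono (Set.ofPred_subset_ofPred.2 fun _ => le_of_lt)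
    _ ≤ (∫ ω, Y n ω ^ 2 ∂P) / √(1 / ε) ^ 2 := measureReal_le_abs_le (hY n) hs
    _ ≤ 1 / √(1 / ε) ^ 2 := by gcongr; exact h n
    _ = ε := by rw [Real.sq_sqrt (by positivity), one_div_one_div]

/-- On `|T| ≤ C` the bound is at most `C |V| + C² |W|`; the thresholds for `V` and `W` give each
term half of `ε`. -/
lemma tendstoInMeasure_zero_of_abs_le {r T V W : ℕ → Ω → ℝ} (hT : BoundedInProbability P T)
    (hV : TendstoInMeasure P V atTop fun _ => 0) (hW : TendstoInMeasure P W atTop fun _ => 0)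
    (hr : Tendsto (fun n => P.real {ω | ¬|r n ω| ≤ |T n ω| * (|V n ω| + |T n ω| * |W n ω|)})
      atTop (𝓝 0)) : TendstoInMeasure P r atTop fun _ => 0 := by
  refine tendstoInMeasure_iff_measureReal_norm.2 fun ε hε => ?_
  simp only [sub_zero, Real.norm_eq_abs]
  rw [Metric.tendsto_nhds]
  intro η hη
  obtain ⟨C', hC'⟩ := boundedInProbability_iff_measureReal.1 hT (η / 5) (by positivity)
  set C := max C' 1
  have hC : 0 < C := lt_of_lt_of_le one_pos (le_max_right _ _)
  have hV' := tendstoInMeasure_iff_measureReal_norm.1 hV (ε / (2 * C)) (by positivity)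
  have hW' := tendstoInMeasure_iff_measureReal_norm.1 hW (ε / (2 * C ^ 2)) (by positivity)
  simp only [sub_zero, Real.norm_eq_abs] at hV' hW'
  have hη5 : 0 < η / 5 := by positivity
  filter_upwards [hC', hV'.eventually_lt_const hη5, hW'.eventually_lt_const hη5,
    hr.eventually_lt_const hη5] with n h1 h2 h3 h4
  rw [Real.dist_eq, sub_zero, abs_of_nonneg measureReal_nonneg]
  have hsub : {ω | ε ≤ |r n ω|} ⊆ (({ω | C' < |T n ω|} ∪ {ω | ε / (2 * C) ≤ |V n ω|})
      ∪ {ω | ε / (2 * C ^ 2) ≤ |W n ω|})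
      ∪ {ω | ¬|r n ω| ≤ |T n ω| * (|V n ω| + |T n ω| * |W n ω|)} := by
    intro ω hω
    by_contra hn
    simp only [Set.mem_union, Set.mem_ofPred_eq, not_or, not_lt, not_le] at hn hω
    obtain ⟨⟨⟨a1, a2⟩, a3⟩, a4⟩ := hn
    have a1' : |T n ω| ≤ C := a1.trans (le_max_left _ _)
    have : |T n ω| * (|V n ω| + |T n ω| * |W n ω|) < ε := by
      calc _ ≤ C * (|V n ω| + C * |W n ω|) := by gcongr
        _ < C * (ε / (2 * C) + C * (ε / (2 * C ^ 2))) := by gcongr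
        _ = ε := by field_simp; norm_num
    linarith
  have := measureReal_mono (μ := P) hsub
  have u1 := measureReal_union_le (μ := P) {ω | C' < |T n ω|} {ω | ε / (2 * C) ≤ |V n ω|}
  have u2 := measureReal_union_le (μ := P)
    ({ω | C' < |T n ω|} ∪ {ω | ε / (2 * C) ≤ |V n ω|}) {ω | ε / (2 * C ^ 2) ≤ |W n ω|}
  have u3 := measureReal_union_le (μ := P)
    (({ω | C' < |T n ω|} ∪ {ω | ε / (2 * C) ≤ |V n ω|}) ∪ {ω | ε / (2 * C ^ 2) ≤ |W n ω|})
    {ω | ¬|r n ω| ≤ |T n ω| * (|V n ω| + |T n ω| * |W n ω|)}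
  linarith

end InProbability

/-! ### Moments of the score and the norming constants -/

section Moments

variable {Ω : Type*} [MeasurableSpace Ω] {P : Measure Ω}
  {φ φ₁ : (n : ℕ) → Fin n → Ω → ℝ → ℝ} {β₀ : ℝ}

lemma scale_nonneg (n : ℕ) : 0 ≤ scale P φ β₀ n := Real.sqrt_nonneg _

lemma scale_sq (n : ℕ) : scale P φ β₀ n ^ 2 = ∑ i, ∫ ω, (φ n i ω β₀) ^ 2 ∂P :=
  Real.sq_sqrt (Finset.sum_nonneg fun _ _ => integral_nonneg fun _ => sq_nonneg _)

lemma scale_mul_gamma (n : ℕ) :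
    scale P φ β₀ n * gamma P φ φ₁ β₀ n = (scale P φ β₀ n)⁻¹ * slope P φ₁ β₀ n := by
  rcases eq_or_ne (scale P φ β₀ n) 0 with h | h
  · simp [h]
  · rw [gamma]; field_simp

lemma scale_sq_mul_gamma {n : ℕ} (h : scale P φ β₀ n ≠ 0) :
    scale P φ β₀ n ^ 2 * gamma P φ φ₁ β₀ n = slope P φ₁ β₀ n := by
  rw [gamma]; field_simp

lemma integral_total_sq [IsProbabilityMeasure P] {n : ℕ}
    (hφ_sq : ∀ i, MemLp (fun ω => φ n i ω β₀) 2 P) {ℱ : Filtration (Fin n) ‹MeasurableSpace Ω›}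
    (hmart : Martingale (fun (j : Fin n) ω => ∑ i ∈ Finset.Iic j, φ n i ω β₀) ℱ P)
    (hmean : ∀ i, ∫ ω, φ n i ω β₀ ∂P = 0) :
    ∫ ω, total φ n ω β₀ ^ 2 ∂P = scale P φ β₀ n ^ 2 := by
  have hX := martingaleDifference_extendZero (Y := fun i ω => φ n i ω β₀)
    (fun i => (hφ_sq i).integrable one_le_two) hmart hmean 1
  have hL2 : ∀ k, MemLp (extendZero (fun i ω => 1 * φ n i ω β₀) k) 2 P := by
    intro k
    by_cases h : k < n
    · rw [extendZero_of_lt _ h]; exact (hφ_sq _).const_mul 1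
    · rw [extendZero_of_not_lt _ h]; exact MemLp.zero
  have h := hX.integral_sum_sq hL2 n
  have e : ∀ ω, ∑ k ∈ Finset.range n, extendZero (fun i ω => 1 * φ n i ω β₀) k ω
      = total φ n ω β₀ := by
    intro ω
    simpa [total] using sum_range_extendZero (fun i ω => 1 * φ n i ω β₀) id ω
  simp_rw [e] at h
  rw [h, scale_sq, Finset.sum_range]
  exact Finset.sum_congr rfl fun i _ => by simp [extendZero_of_lt _ i.2]

/-- Since `eta` is at least one, the factor `η⁻¹` only strengthens the rate. -/
lemma tendsto_inv_mul_of_isLittleO_eta {σ I b : ℕ → ℝ} (h : I =o[atTop] fun n => b n * (eta σ n)⁻¹) :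
    Tendsto (fun n => (b n)⁻¹ * I n) atTop (𝓝 0) := by
  have h1 : (fun n => b n * (eta σ n)⁻¹) =O[atTop] b := by
    refine IsBigO.of_bound 1 (Eventually.of_forall fun n => ?_)
    have he : 1 ≤ eta σ n := le_max_right _ _
    rw [norm_mul, one_mul, norm_inv, Real.norm_of_nonneg (zero_le_one.trans he)]
    exact mul_le_of_le_one_right (norm_nonneg _) (inv_le_one_of_one_le₀ he)
  simpa only [div_eq_inv_mul] using (h.trans_isBigO h1).tendsto_div_nhds_zero

end Moments

/-! ### Roots near the true parameter and their linearization -/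

section LinearRepresentation

/-- At distance `C / a`, after division by `a`, a sign change needs `|u| + C² w ≤ C (γ + v)`. The
left side is at most `C k / 2`, the right side at least `3 C k / 4`. -/
lemma exists_root_of_normalized_le {F : ℝ → ℝ} {β₀ δ a γ k u v w C : ℝ} (ha : 0 < a)
    (hC : 0 < C) (hδ : C / a < δ) (hcont : ContinuousOn F (Metric.ball β₀ δ))
    (hF : ∀ β ∈ Metric.ball β₀ δ,
      |F β - a * u - a ^ 2 * (γ + v) * (β - β₀)| ≤ a ^ 3 * w * (β - β₀) ^ 2)
    (hγ : k < γ) (hu : |u| ≤ C * k / 4) (hv : |v| ≤ k / 4) (hw : |w| ≤ k / (4 * C)) :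
    ∃ β ∈ Metric.ball β₀ δ, F β = 0 ∧ a * |β - β₀| ≤ C := by
  have hsub : Metric.closedBall β₀ (C / a) ⊆ Metric.ball β₀ δ := Metric.closedBall_subset_ball hδ
  obtain ⟨β, hβ, h0⟩ := exists_root_of_abs_sub_le (div_pos hC ha).le (hcont.mono hsub)
    (fun β hβ => hF β (hsub hβ)) (by
      have hCw : C ^ 2 * w ≤ C * k / 4 := by
        calc _ ≤ C ^ 2 * (k / (4 * C)) := by gcongr; exact (le_abs_self w).trans hw
          _ = C * k / 4 := by field_simp
      have hv' := (abs_le.1 hv).1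
      have hk : 0 ≤ k := by have := (abs_nonneg v).trans hv; linarith
      have e1 : |a * u| + a ^ 3 * w * (C / a) ^ 2 = a * (|u| + C ^ 2 * w) := by
        rw [abs_mul, abs_of_pos ha]; field_simp
      have e2 : a ^ 2 * (γ + v) * (C / a) = a * (C * (γ + v)) := by field_simp
      rw [e1, e2]
      refine mul_le_mul_of_nonneg_left ?_ ha.le
      nlinarith [mul_nonneg hC.le hk])
  refine ⟨β, hsub hβ, h0, ?_⟩
  rw [Metric.mem_closedBall, Real.dist_eq, le_div_iff₀ ha] at hβ
  linarith

/-- Here `y` is the deviation of a root from `β₀`: the expansion is divided by `a` and the term `v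
(a y)` is moved to the error. -/
lemma abs_mul_add_le_of_root {y a γ u v w : ℝ} (ha : 0 < a)
    (h : |0 - a * u - a ^ 2 * (γ + v) * y| ≤ a ^ 3 * w * y ^ 2) :
    |a * γ * y + u| ≤ |a * y| * (|v| + |a * y| * |w|) := by
  have h1 : |0 - a * u - a ^ 2 * (γ + v) * y| = a * |a * γ * y + u + v * (a * y)| := by
    rw [← abs_of_pos ha, ← abs_mul, ← abs_neg, abs_of_pos ha]; congr 1; ring
  have h2 : a ^ 3 * w * y ^ 2 = a * (w * |a * y| ^ 2) := by rw [sq_abs]; ring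
  rw [h1, h2] at h
  have h3 : |a * γ * y + u + v * (a * y)| ≤ |w| * |a * y| ^ 2 :=
    (le_of_mul_le_mul_left h ha).trans (by gcongr; exact le_abs_self w)
  calc _ = |(a * γ * y + u + v * (a * y)) - v * (a * y)| := by congr 1; ring
    _ ≤ |a * γ * y + u + v * (a * y)| + |v| * |a * y| := by
        rw [← abs_mul]; exact abs_sub _ _
    _ ≤ _ := by nlinarith

variable {Ω : Type*} [MeasurableSpace Ω] {P : Measure Ω} [IsProbabilityMeasure P]

/-- Existence of roots close to `β₀` and their linear representation, in terms of the normalized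
Taylor coefficients `u`, `v` and `w` of the estimating function. -/
theorem closest_root_asymptotics {F : ℕ → Ω → ℝ → ℝ} {b : ℕ → Ω → ℝ} {β₀ δ k : ℝ} (hδ : 0 < δ)
    (hk : 0 < k) {a γ : ℕ → ℝ} (ha : Tendsto a atTop atTop) (hγ : ∀ᶠ n in atTop, k < γ n)
    {u v w : ℕ → Ω → ℝ} (hu : BoundedInProbability P u)
    (hv : TendstoInMeasure P v atTop fun _ => 0) (hw : TendstoInMeasure P w atTop fun _ => 0)
    {G : Set Ω} (hG : P Gᶜ = 0)
    (hcont : ∀ n, ∀ ω ∈ G, ContinuousOn (F n ω) (Metric.ball β₀ δ))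
    (hF : ∀ n, 0 < a n → ∀ ω ∈ G, ∀ β ∈ Metric.ball β₀ δ,
      |F n ω β - a n * u n ω - a n ^ 2 * (γ n + v n ω) * (β - β₀)|
        ≤ a n ^ 3 * w n ω * (β - β₀) ^ 2)
    (hb : ∀ n ω, b n ω ∈ Metric.ball β₀ δ)
    (hroot : ∀ n, ∀ ω ∈ G, ∀ β ∈ Metric.ball β₀ δ, F n ω β = 0 →
      F n ω (b n ω) = 0 ∧ |b n ω - β₀| ≤ |β - β₀|) :
    Tendsto (fun n => P {ω | F n ω (b n ω) ≠ 0}) atTop (𝓝 0) ∧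
    BoundedInProbability P (fun n ω => a n * (b n ω - β₀)) ∧
    TendstoInMeasure P (fun n ω => a n * γ n * (b n ω - β₀) + u n ω) atTop fun _ => 0 := by
  have hGr : P.real Gᶜ = 0 := by simp [measureReal_def, hG]
  have key : ∀ ε : ℝ, 0 < ε → ∃ C : ℝ, ∀ᶠ n in atTop,
      P.real ({ω | F n ω (b n ω) ≠ 0} ∪ {ω | C < |a n * (b n ω - β₀)|}) ≤ ε := by
    intro ε hε
    obtain ⟨C', hC'⟩ := boundedInProbability_iff_measureReal.1 hu (ε / 3) (by positivity)
    -- The first entry turns `|u| ≤ C'` into `|u| ≤ C k / 4`; the second keeps `C` positive.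
    set C := max (4 * C' / k) 1
    have hC : 0 < C := lt_of_lt_of_le one_pos (le_max_right _ _)
    have hCk : C' ≤ C * k / 4 := by
      have : 4 * C' / k ≤ C := le_max_left _ _
      rw [div_le_iff₀ hk] at this
      linarith
    have hv' := tendstoInMeasure_iff_measureReal_norm.1 hv (k / 4) (by positivity)
    have hw' := tendstoInMeasure_iff_measureReal_norm.1 hw (k / (4 * C)) (by positivity)
    simp only [sub_zero, Real.norm_eq_abs] at hv' hw'
    have hε3 : 0 < ε / 3 := by positivity
    refine ⟨C, ?_⟩
    filter_upwards [hC', hv'.eventually_lt_const hε3, hw'.eventually_lt_const hε3, hγ,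
      ha.eventually_gt_atTop 0, ha.eventually_gt_atTop (C / δ)] with n h1 h2 h3 h4 h5 h6
    -- Off the exceptional events some root lies within `C / a`, so `b` is a root and no farther
    -- from `β₀`.
    have hsub : {ω | F n ω (b n ω) ≠ 0} ∪ {ω | C < |a n * (b n ω - β₀)|}
        ⊆ (({ω | C' < |u n ω|} ∪ {ω | k / 4 ≤ |v n ω|}) ∪ {ω | k / (4 * C) ≤ |w n ω|}) ∪ Gᶜ := by
      intro ω hω
      by_contra hn
      simp only [Set.mem_union, Set.mem_ofPred_eq, not_or, not_lt, not_le, Set.mem_compl_iff,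
        not_not] at hn
      obtain ⟨⟨⟨a1, a2⟩, a3⟩, a4⟩ := hn
      have hCδ : C / a n < δ := by
        rw [div_lt_iff₀ hδ] at h6
        rw [div_lt_iff₀ h5]
        linarith
      obtain ⟨β, hβ, hβ0, hβC⟩ := exists_root_of_normalized_le h5 hC hCδ (hcont n ω a4)
        (hF n h5 ω a4) h4 (a1.trans hCk) a2.le a3.le
      obtain ⟨r1, r2⟩ := hroot n ω a4 β hβ hβ0
      rcases hω with hω | hω
      · exact hω r1
      · refine absurd (show C < |a n * (b n ω - β₀)| from hω) (not_lt.2 ?_)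
        rw [abs_mul, abs_of_pos h5]
        exact (mul_le_mul_of_nonneg_left r2 h5.le).trans hβC
    have u0 := measureReal_mono (μ := P) hsub
    have u1 := measureReal_union_le (μ := P) {ω | C' < |u n ω|} {ω | k / 4 ≤ |v n ω|}
    have u2 := measureReal_union_le (μ := P)
      ({ω | C' < |u n ω|} ∪ {ω | k / 4 ≤ |v n ω|}) {ω | k / (4 * C) ≤ |w n ω|}
    have u3 := measureReal_union_le (μ := P)
      (({ω | C' < |u n ω|} ∪ {ω | k / 4 ≤ |v n ω|}) ∪ {ω | k / (4 * C) ≤ |w n ω|}) Gᶜ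
    linarith
  have hzero : Tendsto (fun n => P.real {ω | F n ω (b n ω) ≠ 0}) atTop (𝓝 0) := by
    rw [Metric.tendsto_nhds]
    intro ε hε
    obtain ⟨C, hC⟩ := key (ε / 2) (by positivity)
    filter_upwards [hC] with n hn
    rw [Real.dist_eq, sub_zero, abs_of_nonneg measureReal_nonneg]
    have := measureReal_mono (μ := P) (Set.subset_union_left
      (s := {ω | F n ω (b n ω) ≠ 0}) (t := {ω | C < |a n * (b n ω - β₀)|}))
    linarith
  have hbdd : BoundedInProbability P (fun n ω => a n * (b n ω - β₀)) := by
    refine boundedInProbability_iff_measureReal.2 fun ε hε => ?_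
    obtain ⟨C, hC⟩ := key ε hε
    exact ⟨C, hC.mono fun n hn => (measureReal_mono Set.subset_union_right).trans hn⟩
  refine ⟨?_, hbdd, ?_⟩
  · refine (ENNReal.tendsto_toReal_iff (fun n => measure_ne_top P _) ENNReal.zero_ne_top).1 ?_
    exact hzero
  · refine tendstoInMeasure_zero_of_abs_le hbdd hv hw ?_
    refine squeeze_zero' (Eventually.of_forall fun _ => measureReal_nonneg) ?_ hzero
    filter_upwards [ha.eventually_gt_atTop 0] with n hn
    calc _ ≤ P.real ({ω | F n ω (b n ω) ≠ 0} ∪ Gᶜ) := by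
          refine measureReal_mono fun ω hω => ?_
          by_contra hcon
          simp only [Set.mem_union, Set.mem_ofPred_eq, not_or, Set.mem_compl_iff, not_not] at hcon
          have h := hF n hn ω hcon.2 (b n ω) (hb n ω)
          rw [hcon.1] at h
          exact hω (abs_mul_add_le_of_root hn h)
      _ ≤ P.real {ω | F n ω (b n ω) ≠ 0} + P.real Gᶜ := measureReal_union_le _ _
      _ = _ := by rw [hGr, add_zero]

end LinearRepresentation

/-! ### Asymptotic normality of the normalized score -/

section AsymptoticNormality

variable {Ω : Type*} [MeasurableSpace Ω] {P : Measure Ω} [IsProbabilityMeasure P]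
  {φ : (n : ℕ) → Fin n → Ω → ℝ → ℝ} {β₀ : ℝ}

lemma tendstoInDistribution_neg_total (hφ_meas : ∀ n i, Measurable fun ω => φ n i ω β₀)
    (hφ_int : ∀ n i, Integrable (fun ω => φ n i ω β₀) P)
    {ℱ : (n : ℕ) → Filtration (Fin n) ‹MeasurableSpace Ω›}
    (hmart : ∀ n, Martingale (fun (j : Fin n) ω => ∑ i ∈ Finset.Iic j, φ n i ω β₀) (ℱ n) P)
    (hmean : ∀ n i, ∫ ω, φ n i ω β₀ ∂P = 0)
    (hsq : TendstoInMeasure P (fun n ω => ∑ i, normalized P φ β₀ n i ω ^ 2) atTop (fun _ => 1))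
    (hmax : Tendsto (fun n => ∫ ω, ⨆ i, |normalized P φ β₀ n i ω| ∂P) atTop (𝓝 0)) :
    TendstoInDistribution (fun n ω => -((scale P φ β₀ n)⁻¹ * total φ n ω β₀)) atTop id
      (fun _ => P) (gaussianReal 0 1) := by
  -- The minus sign is absorbed into the scaling constant; squares and absolute values do not see
  -- it.
  have hX := fun n => martingaleDifference_extendZero (hφ_int n) (hmart n) (hmean n)
    (-(scale P φ β₀ n)⁻¹)
  have hbdd : ∀ n ω, BddAbove (Set.range fun i => |normalized P φ β₀ n i ω|) := fun n ω =>
    (Set.finite_range _).bddAbove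
  have hint : ∀ n i, Integrable (fun ω => |normalized P φ β₀ n i ω|) P := fun n i =>
    ((hφ_int n i).const_mul _).abs
  have hsup0 : ∀ n ω, 0 ≤ ⨆ i, |normalized P φ β₀ n i ω| := fun n ω =>
    Real.iSup_nonneg fun _ => abs_nonneg _
  have hD : ∀ n, Integrable (fun ω => ⨆ i, |normalized P φ β₀ n i ω|) P := by
    intro n
    refine (integrable_finsetSum Finset.univ fun i _ => hint n i).mono'
      (Measurable.iSup fun i => ((hφ_meas n i).const_mul _).abs).aestronglyMeasurable
      (ae_of_all _ fun ω => ?_)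
    rw [Real.norm_of_nonneg (hsup0 n ω)]
    refine Real.iSup_le (fun i => ?_) (Finset.sum_nonneg fun _ _ => abs_nonneg _)
    exact Finset.single_le_sum (f := fun i => |normalized P φ β₀ n i ω|)
      (fun _ _ => abs_nonneg _) (Finset.mem_univ i)
  have hsq' : TendstoInMeasure P (fun n ω => ∑ k ∈ Finset.range n,
      extendZero (fun i ω => -(scale P φ β₀ n)⁻¹ * φ n i ω β₀) k ω ^ 2) atTop (fun _ => 1) := by
    refine hsq.congr_left fun n => ae_of_all _ fun ω => ?_
    refine Eq.trans ?_ (sum_range_extendZero _ (fun x => x ^ 2) ω).symm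
    exact Finset.sum_congr rfl fun i _ => by rw [normalized]; ring
  refine (tendstoInDistribution_sum_of_martingaleDifference hX hsq' hD hsup0
    (fun n k hk ω => ?_) hmax).congr (fun n => ae_of_all _ fun ω => ?_) (ae_eq_refl _)
  · rw [extendZero_of_lt _ hk, neg_mul, abs_neg]
    exact le_ciSup (hbdd n ω) ⟨k, hk⟩
  · simp only
    rw [sum_range_extendZero _ (fun x => x), total, Finset.mul_sum, ← Finset.sum_neg_distrib]
    exact Finset.sum_congr rfl fun i _ => neg_mul _ _

end AsymptoticNormality
end EstimatingEquation

end

/-! ### Assembly of the main theorem -/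

open EstimatingEquation in
theorem theorem3p1
    {Ω : Type*} [MeasurableSpace Ω] (P : Measure Ω) [IsProbabilityMeasure P]
    -- the parameter space, the true parameter, and the random functions `φ`, `φ₁`, `φ₂`
    (B : Set ℝ) (β₀ δ₀ : ℝ) (hδ₀ : 0 < δ₀) (hB : Metric.ball β₀ δ₀ ⊆ B)
    (φ φ₁ φ₂ : (n : ℕ) → Fin n → Ω → ℝ → ℝ)
    (hφ_meas : ∀ n i, ∀ β ∈ B, Measurable fun ω => φ n i ω β)
    -- `φ₁` and `φ₂` are the first two derivatives of `φ` in the parameter, near `β₀`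
    (hφ₁ : ∀ n i, ∀ᵐ ω ∂P, ∀ β ∈ Metric.ball β₀ δ₀, HasDerivAt (φ n i ω) (φ₁ n i ω β) β)
    (hφ₂ : ∀ n i, ∀ᵐ ω ∂P, ∀ β ∈ Metric.ball β₀ δ₀, HasDerivAt (φ₁ n i ω) (φ₂ n i ω β) β)
    -- existence of the moments that occur below
    (hφ_sq : ∀ n i, MemLp (fun ω => φ n i ω β₀) 2 P)
    (hφ₁_int : ∀ n i, Integrable (fun ω => φ₁ n i ω β₀) P)
    -- the norming constants diverge
    (ha : Tendsto (scale P φ β₀) atTop atTop)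
    -- the partial sums of each row form a martingale
    (ℱ : (n : ℕ) → Filtration (Fin n) ‹MeasurableSpace Ω›)
    (hmart : ∀ n, Martingale (fun (j : Fin n) ω => ∑ i ∈ Finset.Iic j, φ n i ω β₀) (ℱ n) P)
    (hmean : ∀ n i, ∫ ω, φ n i ω β₀ ∂P = 0)
    -- the normalized slope stays away from zero
    (k₂ : ℝ) (hk₂ : 0 < k₂) (hγ : ∀ᶠ n in atTop, k₂ < gamma P φ φ₁ β₀ n)
    -- fluctuation of the slope
    (σ : ℕ → ℝ)
    (hφ₁_sq : ∀ n, MemLp (fun ω => ∑ i, (φ₁ n i ω β₀ - ∫ ω', φ₁ n i ω' β₀ ∂P)) 2 P)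
    (hφ₁_o : (fun n => ∫ ω, (∑ i, (φ₁ n i ω β₀ - ∫ ω', φ₁ n i ω' β₀ ∂P)) ^ 2 ∂P)
      =o[atTop] fun n => scale P φ β₀ n ^ 4 * (eta σ n)⁻¹)
    -- domination of the second derivative
    (M : (n : ℕ) → Fin n → Ω → ℝ)
    (hM_meas : ∀ n i, Measurable (M n i))
    (hM_bound : ∀ n i, ∀ᵐ ω ∂P, ∀ β ∈ Metric.ball β₀ δ₀, |φ₂ n i ω β| ≤ M n i ω)
    (hM_sq : ∀ n, MemLp (fun ω => ∑ i, M n i ω) 2 P)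
    (hM_o : (fun n => ∫ ω, (∑ i, M n i ω) ^ 2 ∂P)
      =o[atTop] fun n => scale P φ β₀ n ^ 6 * (eta σ n)⁻¹) :
    ∃ βhat : ℕ → Ω → ℝ,
      (∀ n, Measurable (βhat n)) ∧
      (∀ n ω, βhat n ω ∈ B) ∧
      -- `βhat n` is a root whenever there is one near `β₀`, and it is one with probability
      -- tending to one
      (∀ n, ∀ᵐ ω ∂P, (∃ β ∈ Metric.ball β₀ δ₀, total φ n ω β = 0) →
        total φ n ω (βhat n ω) = 0) ∧
      Tendsto (fun n => P {ω | total φ n ω (βhat n ω) ≠ 0}) atTop (𝓝 0) ∧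
      -- rate of convergence
      BoundedInProbability P (fun n ω => scale P φ β₀ n * (βhat n ω - β₀)) ∧
      -- linear representation
      (∃ r : ℕ → Ω → ℝ,
        TendstoInMeasure P r atTop (fun _ => 0) ∧
        ∀ n ω, scale P φ β₀ n * gamma P φ φ₁ β₀ n * (βhat n ω - β₀)
          = -((scale P φ β₀ n)⁻¹ * total φ n ω β₀) + r n ω) ∧
      -- asymptotic normality
      (TendstoInMeasure P (fun n ω => ∑ i, normalized P φ β₀ n i ω ^ 2) atTop (fun _ => 1) →
        Tendsto (fun n => ∫ ω, ⨆ i, |normalized P φ β₀ n i ω| ∂P) atTop (𝓝 0) →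
        TendstoInDistribution
            (fun n ω => (scale P φ β₀ n)⁻¹ * slope P φ₁ β₀ n * (βhat n ω - β₀))
            atTop id (fun _ => P) (gaussianReal 0 1) ∧
          (Tendsto (gamma P φ φ₁ β₀) atTop (𝓝 1) →
            TendstoInDistribution
              (fun n ω => √(slope P φ₁ β₀ n) * (βhat n ω - β₀))
              atTop id (fun _ => P) (gaussianReal 0 1))) := by
  have hβ₀ : β₀ ∈ Metric.ball β₀ δ₀ := Metric.mem_ball_self hδ₀
  have hae : ∀ᵐ ω ∂P, ∀ n i, (∀ β ∈ Metric.ball β₀ δ₀, HasDerivAt (φ n i ω) (φ₁ n i ω β) β) ∧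
      (∀ β ∈ Metric.ball β₀ δ₀, HasDerivAt (φ₁ n i ω) (φ₂ n i ω β) β) ∧
      ∀ β ∈ Metric.ball β₀ δ₀, |φ₂ n i ω β| ≤ M n i ω :=
    ae_all_iff.2 fun n => ae_all_iff.2 fun i => by
      filter_upwards [hφ₁ n i, hφ₂ n i, hM_bound n i] with ω h1 h2 h3 using ⟨h1, h2, h3⟩
  -- The root selection needs a measurable set on which all the regularity holds at once.
  obtain ⟨G, hG_ae, hG, hGφ⟩ := hae.exists_measurable_mem
  have hcont : ∀ n, ∀ ω ∈ G, ContinuousOn (total φ n ω) (Metric.ball β₀ δ₀) := fun n ω hω =>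
    continuousOn_finsetSum _ fun i _ β hβ =>
      ((hGφ ω hω n i).1 β hβ).continuousAt.continuousWithinAt
  have hsel : ∀ n, _ := fun n => exists_measurable_closest_root (f := total φ n) hδ₀
    (fun β hβ => Finset.measurable_fun_sum _ fun i _ => hφ_meas n i β (hB hβ)) hG (hcont n)
  choose b hb_meas hb_mem hb_root using hsel
  set a := scale P φ β₀ with ha_def
  set γ := gamma P φ φ₁ β₀ with hγ_def
  let u : ℕ → Ω → ℝ := fun n ω => (a n)⁻¹ * total φ n ω β₀
  let v : ℕ → Ω → ℝ := fun n ω =>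
    (a n ^ 2)⁻¹ * ∑ i, (φ₁ n i ω β₀ - ∫ ω', φ₁ n i ω' β₀ ∂P)
  let w : ℕ → Ω → ℝ := fun n ω => (a n ^ 3)⁻¹ * ∑ i, M n i ω
  have htotal_sq : ∀ n, MemLp (fun ω => total φ n ω β₀) 2 P := fun n =>
    memLp_finsetSum _ fun i _ => hφ_sq n i
  have hu : BoundedInProbability P u := by
    refine boundedInProbability_of_integral_sq_le (fun n => (htotal_sq n).const_mul _) fun n => ?_
    simp only [u, mul_pow]
    rw [integral_const_mul, integral_total_sq (hφ_sq n) (hmart n) (hmean n), ← mul_pow]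
    -- This covers `a n = 0` too, where the product is zero.
    exact pow_le_one₀ (mul_nonneg (inv_nonneg.2 (scale_nonneg n)) (scale_nonneg n))
      (inv_mul_le_one)
  have hv : TendstoInMeasure P v atTop fun _ => 0 := by
    refine tendstoInMeasure_zero_of_integral_sq (fun n => (hφ₁_sq n).const_mul _) ?_
    refine (tendsto_inv_mul_of_isLittleO_eta hφ₁_o).congr fun n => ?_
    simp only [v, mul_pow]
    rw [integral_const_mul, inv_pow, ← pow_mul]
  have hw : TendstoInMeasure P w atTop fun _ => 0 := by
    refine tendstoInMeasure_zero_of_integral_sq (fun n => (hM_sq n).const_mul _) ?_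
    refine (tendsto_inv_mul_of_isLittleO_eta hM_o).congr fun n => ?_
    simp only [w, mul_pow]
    rw [integral_const_mul, inv_pow, ← pow_mul]
  have htaylor : ∀ n, 0 < a n → ∀ ω ∈ G, ∀ β ∈ Metric.ball β₀ δ₀,
      |total φ n ω β - a n * u n ω - a n ^ 2 * (γ n + v n ω) * (β - β₀)|
        ≤ a n ^ 3 * w n ω * (β - β₀) ^ 2 := by
    intro n hn ω hω β hβ
    have e1 : a n * u n ω = total φ n ω β₀ := mul_inv_cancel_left₀ hn.ne' _
    have e2 : a n ^ 2 * (γ n + v n ω) = ∑ i, φ₁ n i ω β₀ := by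
      rw [mul_add, hγ_def, ha_def, scale_sq_mul_gamma hn.ne', ← ha_def,
        mul_inv_cancel_left₀ (pow_pos hn 2).ne', Finset.sum_sub_distrib, EstimatingEquation.slope]
      ring
    have e3 : a n ^ 3 * w n ω = ∑ i, M n i ω := mul_inv_cancel_left₀ (pow_pos hn 3).ne' _
    rw [e1, e2, e3]
    exact abs_sub_sub_mul_le_of_hasDerivAt (f₁ := fun β => ∑ i, φ₁ n i ω β)
      (f₂ := fun β => ∑ i, φ₂ n i ω β) hδ₀
      (fun x hx => HasDerivAt.fun_sum fun i _ => (hGφ ω hω n i).1 x hx)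
      (fun x hx => HasDerivAt.fun_sum fun i _ => (hGφ ω hω n i).2.1 x hx)
      (fun x hx => (Finset.abs_sum_le_sum_abs _ _).trans
        (Finset.sum_le_sum fun i _ => (hGφ ω hω n i).2.2 x hx)) hβ
  obtain ⟨hzero, hbdd, hlin⟩ := closest_root_asymptotics hδ₀ hk₂ ha hγ hu hv hw
    (mem_ae_iff.1 hG_ae) hcont htaylor hb_mem hb_root
  refine ⟨b, hb_meas, fun n ω => hB (hb_mem n ω), fun n => ?_, hzero, hbdd,
    ⟨_, hlin, fun n ω => by simp only [u]; ring⟩, fun hsq hmax => ?_⟩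
  · filter_upwards [hG_ae] with ω hω
    rintro ⟨β, hβ, hβ0⟩
    exact (hb_root n ω hω β hβ hβ0).1
  have hnormal : TendstoInDistribution
      (fun n ω => (a n)⁻¹ * slope P φ₁ β₀ n * (b n ω - β₀)) atTop id (fun _ => P)
      (gaussianReal 0 1) := by
    refine tendstoInDistribution_of_tendstoInMeasure_sub _ _
      (tendstoInDistribution_neg_total (fun n i => hφ_meas n i β₀ (hB hβ₀))
        (fun n i => (hφ_sq n i).integrable one_le_two) hmart hmean hsq hmax) ?_
      fun n => (((hb_meas n).sub_const _).const_mul _).aemeasurable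
    refine hlin.congr_left fun n => ae_of_all _ fun ω => ?_
    simp only [Pi.sub_apply, u]
    rw [ha_def, ← scale_mul_gamma]
    ring
  refine ⟨hnormal, fun hγ1 => ?_⟩
  -- Eventually `√slope = a √γ` and `a⁻¹ slope = a γ`, so the two normalizations differ by the
  -- factor `√γ / γ`, and Slutsky's theorem applies.
  have hratio : Tendsto (fun n => √(γ n) / γ n) atTop (𝓝 1) := by
    have h := hγ1.sqrt.div hγ1 one_ne_zero
    rw [Real.sqrt_one, div_one] at h
    exact h
  have hconst : TendstoInMeasure P (fun n (_ : Ω) => √(γ n) / γ n) atTop (fun _ => 1) :=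
    tendstoInMeasure_of_tendsto_ae (fun _ => aestronglyMeasurable_const) (ae_of_all _ fun _ => hratio)
  have hprod := hnormal.continuous_comp_prodMk_of_tendstoInMeasure_const
    (g := fun x : ℝ × ℝ => x.1 * x.2) (by fun_prop) hconst fun _ => aemeasurable_const
  simp only [mul_one] at hprod
  refine tendstoInDistribution_of_tendstoInMeasure_sub _ _ hprod ?_
    fun n => (((hb_meas n).sub_const _).const_mul _).aemeasurable
  refine (tendstoInMeasure_of_tendsto_ae (f := fun _ _ => (0 : ℝ)) (g := fun _ => 0)
    (fun _ => aestronglyMeasurable_const) (ae_of_all _ fun _ => tendsto_const_nhds)).congr' ?_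
    (ae_eq_refl _)
  filter_upwards [hγ, ha.eventually_gt_atTop 0] with n h1 h2
  refine ae_of_all _ fun ω => ?_
  have hγpos : 0 < γ n := hk₂.trans h1
  simp only [Pi.sub_apply]
  rw [← scale_sq_mul_gamma (φ := φ) h2.ne', Real.sqrt_mul (sq_nonneg _), ← ha_def, ← hγ_def,
    Real.sqrt_sq h2.le]
  field_simp
  ring
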